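/- Let $D$ be the open unit disc, $T$ the unit circle with normalized Lebesgue measure $m$, and $1\le p<\infty$. Let $H^p$ be the space of analytic functions $f$ on $D$ with $\|f\|_p^p=\sup_{0<r<1}\int_T|f(r\zeta)|^p\,dm(\zeta)<\infty$. Let $\phi(z)=\lambda\frac{z-a}{1-\bar a z}$ (with $|\lambda|=1$, $a\in D$) and $\psi$ be holomorphic automorphisms of $D$, let $\phi_k$ be the $k$-fold composition of $\phi$ with itself ($\phi_0(z)=z$), and put $$ (U_\phi f)(z)=\bigl(\bar\lambda\,\phi'(z)\bigr)^{1/p} f(\phi(z)),\qquad (M_\psi f)(z)=\psi(z)f(z),\qquad S=M_\psi U_\phi, $$ where the power is the principal branch. Then $S$ is a linear isometry of $H^p$ into $H^p$ whose range has codimension one, each function $\psi\circ\phi_k$ ($k\ge 0$) has exactly one zero $a_k$ in $D$, and $S$ is Crownover, that is, $$\bigcap_{n=1}^\infty S^nH^p=\{0\},$$ if and only if $(a_k)_{k\ge0}$ is not a Blaschke sequence, that is, if and only if $\sum_{k=0}^\infty(1-|a_k|)=\infty$. -/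

import Mathlib

noncomputable section

open Complex Complex.UnitDisc
open scoped ComplexConjugate

namespace HardyIsometry

/-- Parameters `(lam, a)`, `|lam| = 1`, `|a| < 1`, of the disc automorphism
`z ↦ lam (z - a) / (1 - conj a * z)`. Every holomorphic automorphism of the disc arises from exactly
one such pair. -/
structure DiscAut where
  lam : Circle
  a : 𝔻

namespace DiscAut

/-- The formula of the automorphism, as a function on `ℂ`. -/
def formula (φ : DiscAut) (z : ℂ) : ℂ :=
  (φ.lam : ℂ) * (z - (φ.a : ℂ)) / (1 - conj (φ.a : ℂ) * z)

theorem norm_formula_lt_one (φ : DiscAut) (z : 𝔻) : ‖φ.formula (z : ℂ)‖ < 1 := by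
  have ha := φ.a.normSq_lt_one
  have hz := z.normSq_lt_one
  have key : normSq ((z : ℂ) - φ.a) < normSq (1 - conj (φ.a : ℂ) * z) := by
    have h : normSq (1 - conj (φ.a : ℂ) * z) - normSq ((z : ℂ) - φ.a)
        = (1 - normSq (φ.a : ℂ)) * (1 - normSq (z : ℂ)) := by
      simp only [normSq_apply, sub_re, sub_im, mul_re, mul_im, one_re, one_im, conj_re, conj_im]
      ring
    have := mul_pos (sub_pos.2 ha) (sub_pos.2 hz)
    linarith
  have h2 : ‖(z : ℂ) - φ.a‖ < ‖1 - conj (φ.a : ℂ) * z‖ := by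
    rw [normSq_eq_norm_sq, normSq_eq_norm_sq] at key
    exact lt_of_pow_lt_pow_left₀ 2 (norm_nonneg _) key
  rw [formula, norm_div, norm_mul, Circle.norm_coe, one_mul,
    div_lt_one ((norm_nonneg _).trans_lt h2)]
  exact h2

/-- The automorphism as a self-map of the disc. -/
def toMap (φ : DiscAut) (z : 𝔻) : 𝔻 :=
  UnitDisc.mk (φ.formula (z : ℂ)) (φ.norm_formula_lt_one z)

instance : CoeFun DiscAut (fun _ => 𝔻 → 𝔻) := ⟨toMap⟩

end DiscAut

/-- Extension by zero of a function on the disc to `ℂ`. -/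
def zeroExt (f : 𝔻 → ℂ) : ℂ → ℂ := Function.extend UnitDisc.coe f 0

/-- Analyticity of a function on the open unit disc. -/
def IsAnalytic (f : 𝔻 → ℂ) : Prop :=
  DifferentiableOn ℂ (zeroExt f) (Metric.ball 0 1)

/-- `∫_T |f(rζ)|^p dm(ζ)` with `m` the normalized Lebesgue measure on the unit circle. -/
def integralMean (p : ℝ) (f : 𝔻 → ℂ) (r : ℝ) : ℝ :=
  Real.circleAverage (fun z => ‖zeroExt f z‖ ^ p) 0 r

/-- Membership in the Hardy space: `f` is analytic and its integral means are bounded,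
`0 < r < 1`. -/
def MemHp (p : ℝ) (f : 𝔻 → ℂ) : Prop :=
  IsAnalytic f ∧ BddAbove (integralMean p f '' Set.Ioo 0 1)

/-- The Hardy space norm, `(sup_{0<r<1} ∫_T |f(rζ)|^p dm(ζ))^(1/p)`. -/
def hpNorm (p : ℝ) (f : 𝔻 → ℂ) : ℝ :=
  sSup (integralMean p f '' Set.Ioo 0 1) ^ (1 / p)

theorem zeroExt_coe (f : 𝔻 → ℂ) (z : 𝔻) : zeroExt f (z : ℂ) = f z :=
  UnitDisc.coe_injective.extend_apply f 0 z

theorem zeroExt_add (f g : 𝔻 → ℂ) (z : ℂ) : zeroExt (f + g) z = zeroExt f z + zeroExt g z := by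
  by_cases h : ∃ w : 𝔻, (w : ℂ) = z
  · obtain ⟨w, rfl⟩ := h
    simp [zeroExt_coe]
  · simp [zeroExt, Function.extend_apply' _ _ _ h]

theorem zeroExt_smul (c : ℂ) (f : 𝔻 → ℂ) (z : ℂ) : zeroExt (c • f) z = c * zeroExt f z := by
  by_cases h : ∃ w : 𝔻, (w : ℂ) = z
  · obtain ⟨w, rfl⟩ := h
    simp [zeroExt_coe]
  · simp [zeroExt, Function.extend_apply' _ _ _ h]

theorem IsAnalytic.circleIntegrable {p : ℝ} (hp : 0 ≤ p) {f : 𝔻 → ℂ} (hf : IsAnalytic f)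
    {r : ℝ} (hr : r ∈ Set.Ioo (0 : ℝ) 1) :
    CircleIntegrable (fun z => ‖zeroExt f z‖ ^ p) 0 r := by
  refine ContinuousOn.circleIntegrable hr.1.le ?_
  refine ContinuousOn.rpow_const ?_ (fun _ _ => Or.inr hp)
  refine (hf.continuousOn.mono ?_).norm
  exact Metric.sphere_subset_ball hr.2

/-- The Hardy space `H^p` of the disc, `1 ≤ p < ∞`, as a space of functions on the disc. -/
def Hp (p : ℝ) (hp : 1 ≤ p) : Submodule ℂ (𝔻 → ℂ) where
  carrier := {f | MemHp p f}
  zero_mem' := by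
    have h0 : zeroExt (0 : 𝔻 → ℂ) = 0 := by
      funext z
      simpa using zeroExt_smul 0 0 z
    have hp0 : p ≠ 0 := by linarith
    refine ⟨by simp [IsAnalytic, h0], 0, ?_⟩
    rintro _ ⟨r, -, rfl⟩
    simp [integralMean, h0, Real.zero_rpow hp0, Real.circleAverage_const]
  add_mem' := by
    rintro f g ⟨hf, A, hA⟩ ⟨hg, B, hB⟩
    have hfg : IsAnalytic (f + g) := by
      have : zeroExt (f + g) = fun z => zeroExt f z + zeroExt g z := funext (zeroExt_add f g)
      rw [IsAnalytic, this]
      exact DifferentiableOn.add hf hg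
    refine ⟨hfg, 2 ^ (p - 1) * (A + B), ?_⟩
    rintro _ ⟨r, hr, rfl⟩
    have hp0 : 0 ≤ p := by linarith
    have h2 : (0 : ℝ) ≤ 2 ^ (p - 1) := by positivity
    have hIf := hf.circleIntegrable hp0 hr
    have hIg := hg.circleIntegrable hp0 hr
    calc integralMean p (f + g) r
        ≤ Real.circleAverage ((2 ^ (p - 1) : ℝ) •
            ((fun z => ‖zeroExt f z‖ ^ p) + fun z => ‖zeroExt g z‖ ^ p)) 0 r := by
          refine Real.circleAverage_mono (hfg.circleIntegrable hp0 hr)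
            ((hIf.add hIg).const_smul) ?_
          intro z _
          simp only [Pi.smul_apply, Pi.add_apply, smul_eq_mul]
          rw [zeroExt_add]
          refine (Real.rpow_le_rpow (norm_nonneg _) (norm_add_le _ _) hp0).trans ?_
          exact_mod_cast NNReal.rpow_add_le_mul_rpow_add_rpow ‖zeroExt f z‖₊ ‖zeroExt g z‖₊ hp
      _ = 2 ^ (p - 1) * (integralMean p f r + integralMean p g r) := by
          rw [Real.circleAverage_smul, Real.circleAverage_add hIf hIg]
          rfl
      _ ≤ 2 ^ (p - 1) * (A + B) := by
          refine mul_le_mul_of_nonneg_left (add_le_add ?_ ?_) h2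
          · exact hA ⟨r, hr, rfl⟩
          · exact hB ⟨r, hr, rfl⟩
  smul_mem' := by
    rintro c f ⟨hf, A, hA⟩
    have hcf : zeroExt (c • f) = fun z => c * zeroExt f z := funext (zeroExt_smul c f)
    refine ⟨?_, ‖c‖ ^ p * A, ?_⟩
    · rw [IsAnalytic, hcf]
      exact DifferentiableOn.const_mul hf c
    rintro _ ⟨r, hr, rfl⟩
    have : integralMean p (c • f) r = ‖c‖ ^ p * integralMean p f r := by
      rw [integralMean, integralMean, ← smul_eq_mul, ← Real.circleAverage_smul, hcf]
      congr 1
      funext z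
      simp [Real.mul_rpow]
    rw [this]
    exact mul_le_mul_of_nonneg_left (hA ⟨r, hr, rfl⟩) (by positivity)

/-- `M_F`, multiplication by `F`. -/
def mulOp (F : 𝔻 → ℂ) : Module.End ℂ (𝔻 → ℂ) := LinearMap.mulLeft ℂ F

/-- `C_φ`, composition `f ↦ f ∘ φ`. -/
def compOp (φ : DiscAut) : Module.End ℂ (𝔻 → ℂ) := LinearMap.funLeft ℂ ℂ φ

/-- `U_φ = M_{(conj lam * φ')^(1/p)} C_φ` with the principal branch of the power. -/
def U (p : ℝ) (φ : DiscAut) : Module.End ℂ (𝔻 → ℂ) :=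
  mulOp (fun z => (conj (φ.lam : ℂ) * deriv φ.formula (z : ℂ)) ^ ((1 / p : ℝ) : ℂ)) * compOp φ

/-- `S = M_ψ U_φ`. -/
def S (p : ℝ) (ψ φ : DiscAut) : Module.End ℂ (𝔻 → ℂ) :=
  mulOp (fun z => (ψ z : ℂ)) * U p φ

/-- The linear operator `T` maps `H^p` isometrically into `H^p`, and `T H^p` has codimension one
in `H^p`. -/
def IsCodimOneIsometry (p : ℝ) (hp : 1 ≤ p) (T : Module.End ℂ (𝔻 → ℂ)) : Prop :=
  (∀ f ∈ Hp p hp, T f ∈ Hp p hp ∧ hpNorm p (T f) = hpNorm p f) ∧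
    Module.finrank ℂ (Hp p hp ⧸ ((Hp p hp).map T).submoduleOf (Hp p hp)) = 1

/-- A codimension-one isometry `T` of `H^p` is Crownover if `⋂_{n ≥ 1} T^n H^p = 0`. -/
def IsCrownover (p : ℝ) (hp : 1 ≤ p) (T : Module.End ℂ (𝔻 → ℂ)) : Prop :=
  IsCodimOneIsometry p hp T ∧ (⨅ n : ℕ, ⨅ _ : 1 ≤ n, (Hp p hp).map (T ^ n)) = ⊥

/-- A Blaschke sequence in the disc: `∑ (1 - |z_k|) < ∞`. -/
def IsBlaschkeSeq (z : ℕ → 𝔻) : Prop :=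
  Summable fun k => 1 - ‖(z k : ℂ)‖

end HardyIsometry

end

noncomputable section

open Complex Complex.UnitDisc
open scoped ComplexConjugate

namespace HardyIsometry

/-! ### Algebra and boundary behaviour of disc automorphisms. -/

namespace DiscAut

/-! On the circle `conj lam * φ'` has modulus equal to the Jacobian of `φ`, so the change of
variables `DiscAut.circleAverage_comp` makes `U` an isometry of `H^p`, and `exists_U_eq` makes it
onto. Since `|ψ| → 1` at the boundary, multiplication by `ψ` is isometric as well
(`DiscAut.normPow_mul`), with image the functions vanishing at the zero of `ψ`. Hence the range of
`S` is the kernel of a point evaluation, which has codimension one.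

Iterating, `S^n f = B_n · U^n f` with `B_n = ∏_{k<n} ψ ∘ φ_k` (`S_pow_apply`). As `U^n` is onto,
`S^n H^p = B_n H^p`. Each `ψ ∘ φ_k` is again a disc automorphism `χ k`, so `B_n` is a finite
Blaschke product up to a unimodular constant.

If `∑ (1 - |a_k|)` diverges, then `B_n(z) → 0` at every point `z`. An `f` in all the ranges is `B_n
g_n` with `‖g_n‖ = ‖f‖`, and boundedness of point evaluation (`one_sub_sq_mul_norm_rpow_le`) forces
`f(z) = 0`. If the sum converges, the infinite Blaschke product is a nonzero bounded function whose
quotient by every `B_n` is bounded, so it lies in all the ranges.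

No boundary values of `H^p` functions are used: everything is done with means over circles of radius
less than one, dilations, and monotonicity of the means in the radius. -/

theorem re_denominator_pos (φ : DiscAut) {z : ℂ} (hz : ‖z‖ ≤ 1) :
    0 < (1 - conj (φ.a : ℂ) * z).re := by
  have h : ‖conj (φ.a : ℂ) * z‖ < 1 := by
    rw [norm_mul, RCLike.norm_conj]
    have := φ.a.norm_lt_one
    nlinarith [norm_nonneg (φ.a : ℂ), norm_nonneg z]
  have := (re_le_norm (conj (φ.a : ℂ) * z)).trans_lt h
  simp only [sub_re, one_re]
  linarith

theorem denominator_ne_zero (φ : DiscAut) {z : ℂ} (hz : ‖z‖ ≤ 1) :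
    1 - conj (φ.a : ℂ) * z ≠ 0 := fun h => by
  have := φ.re_denominator_pos hz
  simp [h] at this

theorem one_sub_normSq_pos (φ : DiscAut) : 0 < 1 - normSq (φ.a : ℂ) :=
  sub_pos.2 φ.a.normSq_lt_one

/-- The Schwarz–Pick identity. It gives `|φ| = 1` on the circle, the uniform approach of `|φ|` to 1
at the boundary, and the comparison of `1 - |φ z|` with `1 - |a|`. -/
theorem one_sub_norm_formula_sq (φ : DiscAut) {z : ℂ} (hz : ‖z‖ ≤ 1) :
    1 - ‖φ.formula z‖ ^ 2 =
      (1 - ‖(φ.a : ℂ)‖ ^ 2) * (1 - ‖z‖ ^ 2) / ‖1 - conj (φ.a : ℂ) * z‖ ^ 2 := by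
  have h0 : ‖1 - conj (φ.a : ℂ) * z‖ ^ 2 ≠ 0 := by
    simpa using φ.denominator_ne_zero hz
  rw [formula, norm_div, norm_mul, Circle.norm_coe, one_mul, eq_div_iff h0, sub_mul, div_pow,
    div_mul_cancel₀ _ h0, one_mul]
  simp only [← normSq_eq_norm_sq, normSq_apply, sub_re, sub_im, mul_re, mul_im, one_re, one_im,
    conj_re, conj_im]
  ring

theorem norm_formula_of_norm_eq_one (φ : DiscAut) {z : ℂ} (hz : ‖z‖ = 1) : ‖φ.formula z‖ = 1 := by
  have h := φ.one_sub_norm_formula_sq hz.le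
  rw [hz] at h
  have : ‖φ.formula z‖ ^ 2 = 1 := by
    simp only [one_pow, sub_self, mul_zero, zero_div] at h
    linarith
  exact (pow_eq_one_iff_of_nonneg (norm_nonneg _) two_ne_zero).1 this

theorem norm_formula_lt_one' (φ : DiscAut) {z : ℂ} (hz : ‖z‖ < 1) : ‖φ.formula z‖ < 1 :=
  φ.norm_formula_lt_one (UnitDisc.mk z hz)

theorem norm_formula_le_one (φ : DiscAut) {z : ℂ} (hz : ‖z‖ ≤ 1) : ‖φ.formula z‖ ≤ 1 := by
  rcases hz.lt_or_eq with h | h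
  · exact (φ.norm_formula_lt_one' h).le
  · exact (φ.norm_formula_of_norm_eq_one h).le

@[simp]
theorem coe_apply (φ : DiscAut) (z : 𝔻) : ((φ z : 𝔻) : ℂ) = φ.formula z := rfl

theorem apply_eq_zero_iff (φ : DiscAut) (z : 𝔻) : φ z = 0 ↔ z = φ.a := by
  rw [← UnitDisc.coe_eq_zero, coe_apply, formula, div_eq_zero_iff,
    or_iff_left (φ.denominator_ne_zero z.norm_lt_one.le), mul_eq_zero,
    or_iff_right (Circle.coe_ne_zero _), sub_eq_zero, UnitDisc.coe_inj]

theorem hasDerivAt_formula (φ : DiscAut) {z : ℂ} (hz : ‖z‖ ≤ 1) :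
    HasDerivAt φ.formula
      ((φ.lam : ℂ) * ((1 - normSq (φ.a : ℂ) : ℝ) / (1 - conj (φ.a : ℂ) * z) ^ 2)) z := by
  have h0 := φ.denominator_ne_zero hz
  have h1 : HasDerivAt (fun z : ℂ => (φ.lam : ℂ) * (z - φ.a)) ((φ.lam : ℂ) * 1) z :=
    ((hasDerivAt_id z).sub_const _).const_mul _
  have h2 : HasDerivAt (fun z : ℂ => 1 - conj (φ.a : ℂ) * z) (-(conj (φ.a : ℂ) * 1)) z :=
    ((hasDerivAt_id z).const_mul _).const_sub _
  refine (h1.div h2 h0).congr_deriv ?_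
  rw [← mul_div_assoc]
  congr 1
  have := Complex.mul_conj (φ.a : ℂ)
  push_cast
  rw [← this]
  ring

theorem conj_lam_mul_lam (φ : DiscAut) : conj (φ.lam : ℂ) * φ.lam = 1 := by
  rw [mul_comm, Complex.mul_conj, Circle.normSq_coe, ofReal_one]

theorem conj_lam_mul_deriv_formula (φ : DiscAut) {z : ℂ} (hz : ‖z‖ ≤ 1) :
    conj (φ.lam : ℂ) * deriv φ.formula z =
      (1 - normSq (φ.a : ℂ) : ℝ) / (1 - conj (φ.a : ℂ) * z) ^ 2 := by
  rw [(φ.hasDerivAt_formula hz).deriv, ← mul_assoc, conj_lam_mul_lam, one_mul]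

/-- The quotient `(1 - |a|²) / (1 - conj a * z)²`, which is `conj lam * φ'` on the closed disc. -/
def derivFactor (φ : DiscAut) (z : ℂ) : ℂ :=
  (1 - normSq (φ.a : ℂ) : ℝ) / (1 - conj (φ.a : ℂ) * z) ^ 2

/-- The denominator has positive real part, so its square avoids the closed negative axis; inversion
and positive scaling preserve this. Hence the principal power in the weight is analytic up to the
boundary. -/
theorem derivFactor_mem_slitPlane (φ : DiscAut) {z : ℂ} (hz : ‖z‖ ≤ 1) :
    φ.derivFactor z ∈ slitPlane := by
  have hd := φ.re_denominator_pos hz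
  set d := 1 - conj (φ.a : ℂ) * z
  have h2 : d ^ 2 ∈ slitPlane := by
    rw [mem_slitPlane_iff, pow_two, mul_re, mul_im]
    by_cases hy : d.im = 0
    · left; rw [hy]; nlinarith
    · right
      intro h
      have : d.re * d.im = 0 := by linarith
      exact (mul_ne_zero hd.ne' hy) this
  have h3 : (d ^ 2)⁻¹ ∈ slitPlane := by
    rw [mem_slitPlane_iff_arg] at h2 ⊢
    exact ⟨by rw [arg_inv, if_neg h2.1]; intro h; linarith [neg_pi_lt_arg (d ^ 2)],
      inv_ne_zero h2.2⟩
  rw [derivFactor, div_eq_mul_inv]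
  rw [mem_slitPlane_iff] at h3 ⊢
  rw [re_ofReal_mul, im_ofReal_mul]
  have hp := φ.one_sub_normSq_pos
  exact h3.imp (fun h => mul_pos hp h) (fun h => mul_ne_zero (ne_of_gt hp) h)

/-- The weight `(conj lam * φ')^(1/p)` of `U_φ`, extended to the closed disc. -/
def weight (p : ℝ) (φ : DiscAut) (z : ℂ) : ℂ := φ.derivFactor z ^ ((1 / p : ℝ) : ℂ)

theorem weight_ne_zero (p : ℝ) (φ : DiscAut) {z : ℂ} (hz : ‖z‖ ≤ 1) : φ.weight p z ≠ 0 := by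
  rw [weight, Ne, cpow_eq_zero_iff]
  exact fun h => slitPlane_ne_zero (φ.derivFactor_mem_slitPlane hz) h.1

theorem norm_weight_rpow {p : ℝ} (hp : 1 ≤ p) (φ : DiscAut) (z : ℂ) :
    ‖φ.weight p z‖ ^ p = (1 - normSq (φ.a : ℂ)) / ‖1 - conj (φ.a : ℂ) * z‖ ^ 2 := by
  rw [weight, norm_cpow_real, ← Real.rpow_mul (norm_nonneg _),
    one_div_mul_cancel (by linarith), Real.rpow_one, derivFactor, norm_div, norm_pow, norm_real,
    Real.norm_of_nonneg φ.one_sub_normSq_pos.le]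

theorem differentiableAt_weight (p : ℝ) (φ : DiscAut) {z : ℂ} (hz : ‖z‖ ≤ 1) :
    DifferentiableAt ℂ (φ.weight p) z := by
  refine DifferentiableAt.cpow_const ?_ (φ.derivFactor_mem_slitPlane hz)
  unfold derivFactor
  refine DifferentiableAt.div (by fun_prop) (by fun_prop) ?_
  exact pow_ne_zero _ (φ.denominator_ne_zero hz)

theorem differentiableAt_formula (φ : DiscAut) {z : ℂ} (hz : ‖z‖ ≤ 1) :
    DifferentiableAt ℂ φ.formula z := (φ.hasDerivAt_formula hz).differentiableAt

/-- The inverse automorphism. -/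
def inv (φ : DiscAut) : DiscAut where
  lam := φ.lam⁻¹
  a := -(φ.lam • φ.a)

theorem coe_inv_lam (φ : DiscAut) : (φ.inv.lam : ℂ) = conj (φ.lam : ℂ) :=
  Circle.coe_inv_eq_conj φ.lam

theorem coe_inv_a (φ : DiscAut) : (φ.inv.a : ℂ) = -((φ.lam : ℂ) * φ.a) := rfl

theorem formula_inv_formula (φ : DiscAut) {z : ℂ} (hz : ‖z‖ ≤ 1) :
    φ.inv.formula (φ.formula z) = z := by
  have h1 := φ.inv.denominator_ne_zero (φ.norm_formula_le_one hz)
  have hq := div_mul_cancel₀ (z - φ.a) (φ.denominator_ne_zero hz)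
  rw [formula, div_eq_iff h1, coe_inv_lam, coe_inv_a, formula, mul_div_assoc]
  generalize (z - (φ.a : ℂ)) / (1 - conj (φ.a : ℂ) * z) = q at hq
  simp only [map_neg, map_mul]
  linear_combination (q + φ.a - z * conj (φ.a : ℂ) * q) * φ.conj_lam_mul_lam + hq

theorem inv_apply_apply (φ : DiscAut) (z : 𝔻) : φ.inv (φ z) = z :=
  UnitDisc.coe_injective (φ.formula_inv_formula z.norm_lt_one.le)

theorem inv_inv (φ : DiscAut) : φ.inv.inv = φ := by
  have h : φ.inv.inv.a = φ.a := by
    rw [← UnitDisc.coe_inj, coe_inv_a, coe_inv_a, coe_inv_lam]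
    linear_combination (φ.a : ℂ) * φ.conj_lam_mul_lam
  have h' : φ.inv.inv.lam = φ.lam := _root_.inv_inv φ.lam
  calc φ.inv.inv = ⟨φ.inv.inv.lam, φ.inv.inv.a⟩ := rfl
    _ = φ := by rw [h, h']

theorem apply_inv_apply (φ : DiscAut) (z : 𝔻) : φ (φ.inv z) = z := by
  simpa [inv_inv] using φ.inv.inv_apply_apply z

/-- The composite vanishes at `ψ⁻¹(φ.a)`; this fixes its second parameter, and the rotation picks up
a unimodular factor `conj D / D`. -/
theorem exists_comp (φ ψ : DiscAut) : ∃ χ : DiscAut, ∀ z : 𝔻, χ z = φ (ψ z) := by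
  -- Conjugates become independent variables: `M, A, B, c'` stand for the conjugates of `m, a, b,
  -- c`, and `q` for `ψ z`. Here `e1` matches the numerators and `e2` the denominators.
  have key : ∀ l m M a A b B z q c c' : ℂ, M * m = 1 → q * (1 - B * z) = m * (z - b) →
      c * (1 + M * B * a) = M * (a + m * b) → c' * (1 + m * b * A) = m * (A + M * B) →
      1 + m * b * A ≠ 0 →
      l * m * ((1 + M * B * a) / (1 + m * b * A)) * (z - c) * (1 - A * q) =
        l * (q - a) * (1 - c' * z) := by
    intro l m M a A b B z q c c' hm hq hc hc' hd
    have e1 : m * ((1 + M * B * a) * (z - c)) = (1 - B * z) * (q - a) := by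
      linear_combination -m * hc - hq + (B * a * z - a - m * b) * hm
    have e2 : (1 + m * b * A) * (1 - c' * z) = (1 - B * z) * (1 - A * q) := by
      linear_combination -z * hc' + A * hq - B * z * hm
    rw [mul_div_assoc', div_mul_eq_mul_div, div_mul_eq_mul_div, div_eq_iff hd]
    linear_combination l * (1 - A * q) * e1 - l * (q - a) * e2
  have hD := ψ.inv.denominator_ne_zero φ.a.norm_lt_one.le
  have hd : 1 - ψ.inv.a * conj (φ.a : ℂ) ≠ 0 := by
    simpa using (map_ne_zero (starRingEnd ℂ)).2 hD
  refine ⟨⟨φ.lam * ψ.lam * Circle.ofConjDivSelf _ hd, ψ.inv φ.a⟩, fun z => ?_⟩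
  have hz := z.norm_lt_one.le
  have h1 := DiscAut.denominator_ne_zero
    ⟨φ.lam * ψ.lam * Circle.ofConjDivSelf _ hd, ψ.inv φ.a⟩ hz
  have h2 := φ.denominator_ne_zero (ψ.norm_formula_le_one hz)
  have hq : ψ.formula z = ψ.lam * (z - ψ.a) / (1 - conj (ψ.a : ℂ) * z) := rfl
  rw [eq_div_iff (ψ.denominator_ne_zero hz)] at hq
  have hc : ψ.inv.formula φ.a = ψ.inv.lam * (φ.a - ψ.inv.a) / (1 - conj (ψ.inv.a : ℂ) * φ.a) := rfl
  rw [eq_div_iff hD] at hc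
  have hc' := congrArg conj hc
  have he : ((Circle.ofConjDivSelf _ hd : Circle) : ℂ) =
      conj (1 - ψ.inv.a * conj (φ.a : ℂ)) / (1 - ψ.inv.a * conj (φ.a : ℂ)) := rfl
  rw [← UnitDisc.coe_inj, coe_apply, coe_apply, coe_apply, formula, formula.eq_def φ,
    div_eq_div_iff h1 h2, Circle.coe_mul, Circle.coe_mul, he, coe_apply]
  simp only [map_mul, map_add, map_one, Complex.conj_conj, coe_inv_lam, coe_inv_a, map_neg,
    neg_mul, sub_neg_eq_add] at hd hc hc' ⊢
  exact key _ _ _ _ _ _ _ _ _ _ _ ψ.conj_lam_mul_lam hq hc hc' hd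

end DiscAut

open MeasureTheory Real Filter Topology Metric

/-! ### Circle averages: sub-mean value property, monotonicity in the radius, change of variables.
-/

theorem continuous_comp_circleMap {E : Type*} [TopologicalSpace E] {h : ℂ → E}
    (hh : ContinuousOn h (sphere 0 1)) : Continuous fun θ : ℝ => h (circleMap 0 1 θ) :=
  hh.comp_continuous (continuous_circleMap 0 1) fun θ => circleMap_mem_sphere 0 zero_le_one θ

theorem circleAverage_mul_left_unit {h : ℂ → ℝ} {c : ℂ} (hc : ‖c‖ = 1) :
    circleAverage (fun z => h (c * z)) 0 1 = circleAverage h 0 1 := by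
  rw [circleAverage_eq_integral_add (f := h) (arg c), circleAverage]
  congr 2 with θ
  congr 1
  have hc' : cexp (arg c * I) = c := by simpa [hc] using norm_mul_exp_arg_mul_I c
  simp only [circleMap_zero, ofReal_one, one_mul, ofReal_add, add_mul, Complex.exp_add, hc']
  ring

/-- Jensen's inequality for the convex function `t ↦ t ^ p`; this is where `1 ≤ p` enters. -/
theorem norm_circleAverage_rpow_le {p : ℝ} (hp : 1 ≤ p) {F : ℂ → ℂ}
    (hF : ContinuousOn F (sphere 0 1)) :
    ‖circleAverage F 0 1‖ ^ p ≤ circleAverage (fun z => ‖F z‖ ^ p) 0 1 := by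
  have hc := continuous_comp_circleMap hF
  have hpos : (0 : ℝ) < 2 * π := two_pi_pos
  have h1 : ‖circleAverage F 0 1‖ ≤ circleAverage (fun z => ‖F z‖) 0 1 := by
    rw [circleAverage, circleAverage, norm_smul, Real.norm_of_nonneg (inv_pos.2 hpos).le,
      smul_eq_mul]
    exact mul_le_mul_of_nonneg_left (intervalIntegral.norm_integral_le_integral_norm hpos.le)
      (inv_pos.2 hpos).le
  refine (Real.rpow_le_rpow (norm_nonneg _) h1 (by linarith)).trans ?_
  rw [circleAverage_eq_intervalAverage, circleAverage_eq_intervalAverage]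
  have : NeZero (volume.restrict (Set.uIoc 0 (2 * π))) :=
    ⟨by rw [Ne, Measure.restrict_eq_zero, Set.uIoc_of_le hpos.le]; simp [pi_pos]⟩
  have : IsFiniteMeasure (volume.restrict (Set.uIoc 0 (2 * π))) := by
    rw [Set.uIoc_of_le hpos.le]; infer_instance
  have hint : ∀ g : ℝ → ℝ, Continuous g →
      Integrable g (volume.restrict (Set.uIoc 0 (2 * π))) := fun g hg =>
    intervalIntegrable_iff.1 (hg.intervalIntegrable _ _)
  exact (convexOn_rpow hp).map_average_le
    (continuousOn_id.rpow_const fun _ _ => Or.inr (by linarith)) isClosed_Ici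
    (ae_of_all _ fun θ => norm_nonneg _) (hint _ hc.norm)
    (hint _ (hc.norm.rpow_const fun _ => Or.inr (by linarith)))

/-- Sub-mean value property of `‖F‖ ^ p` at the centre of the disc. -/
theorem norm_rpow_le_circleAverage {p : ℝ} (hp : 1 ≤ p) {F : ℂ → ℂ}
    (hF : DiffContOnCl ℂ F (ball 0 1)) :
    ‖F 0‖ ^ p ≤ circleAverage (fun z => ‖F z‖ ^ p) 0 1 := by
  have h : circleAverage F 0 1 = F 0 := DiffContOnCl.circleAverage (by simpa using hF)
  rw [← h]
  refine norm_circleAverage_rpow_le hp (hF.continuousOn.mono ?_)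
  rw [closure_ball _ one_ne_zero]
  exact sphere_subset_closedBall

theorem DiscAut.diffContOnCl_comp {F : ℂ → ℂ} (hF : DiffContOnCl ℂ F (ball 0 1)) (φ : DiscAut) :
    DiffContOnCl ℂ (fun z => F (φ.formula z)) (ball 0 1) := by
  refine hF.comp ⟨fun z hz => ?_, fun z hz => ?_⟩ fun z hz => ?_
  · exact (φ.differentiableAt_formula (mem_ball_zero_iff.1 hz).le).differentiableWithinAt
  · rw [closure_ball _ one_ne_zero] at hz
    exact (φ.differentiableAt_formula
      (mem_closedBall_zero_iff.1 hz)).continuousAt.continuousWithinAt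
  · exact mem_ball_zero_iff.2 (φ.norm_formula_lt_one' (mem_ball_zero_iff.1 hz))

/-- The integral mean over a smaller concentric circle is at most the one over the unit circle. -/
theorem circleAverage_rpow_le {p : ℝ} (hp : 1 ≤ p) {F : ℂ → ℂ}
    (hF : DiffContOnCl ℂ F (ball 0 1)) {r : ℝ} (hr0 : 0 ≤ r) (hr : r < 1) :
    circleAverage (fun z => ‖F z‖ ^ p) 0 r ≤ circleAverage (fun z => ‖F z‖ ^ p) 0 1 := by
  have hp0 : 0 ≤ p := by linarith
  have hcont : ContinuousOn F (closedBall 0 1) := by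
    simpa [closure_ball _ (one_ne_zero (α := ℝ))] using hF.continuousOn
  -- `u` sends 0 to `r`. The sub-mean value property of `z ↦ F(ζ u(z))` at 0 bounds `‖F(rζ)‖ ^ p`.
  -- Averaging over `ζ` and swapping the integrals leaves, for each `t`, a rotation by the
  -- unimodular number `u(e^{it})`, which does not change the average.
  let u : DiscAut := ⟨1, UnitDisc.mk (-(r : ℂ)) (by simpa [abs_of_nonneg hr0] using hr)⟩
  have hu0 : u.formula 0 = r := by simp [u, DiscAut.formula]
  have hu1 : ∀ t, ‖u.formula (circleMap 0 1 t)‖ = 1 := fun t =>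
    u.norm_formula_of_norm_eq_one (by simp)
  have hcm : ∀ (s θ : ℝ), circleMap 0 s θ = circleMap 0 1 θ * s := fun s θ => by
    simp [circleMap_zero, mul_comm]
  have hpt : ∀ θ : ℝ, ‖F (circleMap 0 r θ)‖ ^ p ≤
      circleAverage (fun z => ‖F (circleMap 0 1 θ * u.formula z)‖ ^ p) 0 1 := by
    intro θ
    have h1 : DiffContOnCl ℂ (fun z => F (circleMap 0 1 θ * z)) (ball 0 1) := by
      refine hF.comp (Differentiable.diffContOnCl (by fun_prop)) fun z hz => ?_
      simpa using hz
    have := norm_rpow_le_circleAverage hp (u.diffContOnCl_comp h1)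
    simpa only [hu0, ← hcm r θ] using this
  have hucont : Continuous fun t : ℝ => u.formula (circleMap 0 1 t) :=
    continuous_comp_circleMap fun z hz =>
      (u.differentiableAt_formula (mem_sphere_zero_iff_norm.1 hz).le).continuousAt.continuousWithinAt
  have hH : Continuous fun x : ℝ × ℝ =>
      ‖F (circleMap 0 1 x.1 * u.formula (circleMap 0 1 x.2))‖ ^ p := by
    refine (Continuous.norm ?_).rpow_const fun _ => Or.inr hp0
    refine hcont.comp_continuous ?_ fun x => ?_
    · exact ((continuous_circleMap 0 1).comp continuous_fst).mul (hucont.comp continuous_snd)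
    · simp [hu1]
  have hpos : (0 : ℝ) < 2 * π := two_pi_pos
  calc circleAverage (fun z => ‖F z‖ ^ p) 0 r
      ≤ (2 * π)⁻¹ * ∫ θ in 0..2 * π,
          circleAverage (fun z => ‖F (circleMap 0 1 θ * u.formula z)‖ ^ p) 0 1 := by
        rw [circleAverage, smul_eq_mul]
        refine mul_le_mul_of_nonneg_left ?_ (inv_pos.2 hpos).le
        refine intervalIntegral.integral_mono hpos.le ?_ ?_ hpt
        · refine Continuous.intervalIntegrable ?_ _ _
          refine (Continuous.norm ?_).rpow_const fun _ => Or.inr hp0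
          exact hcont.comp_continuous (continuous_circleMap 0 r) fun θ => by
            simpa [abs_of_nonneg hr0] using hr.le
        · refine Continuous.intervalIntegrable ?_ _ _
          simp only [circleAverage]
          exact (intervalIntegral.continuous_parametric_intervalIntegral_of_continuous'
            (μ := volume) (f := fun θ t => ‖F (circleMap 0 1 θ * u.formula (circleMap 0 1 t))‖ ^ p) hH 0 (2 * π)).const_smul (2 * π)⁻¹
    _ = (2 * π)⁻¹ * ((2 * π)⁻¹ * ∫ θ in 0..2 * π, ∫ t in 0..2 * π,
          ‖F (circleMap 0 1 θ * u.formula (circleMap 0 1 t))‖ ^ p) := by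
        simp only [circleAverage, smul_eq_mul, intervalIntegral.integral_const_mul]
    _ = (2 * π)⁻¹ * ((2 * π)⁻¹ * ∫ t in 0..2 * π, ∫ θ in 0..2 * π,
          ‖F (circleMap 0 1 θ * u.formula (circleMap 0 1 t))‖ ^ p) := by
        rw [intervalIntegral_intervalIntegral_swap]
        refine (hH.continuousOn.integrableOn_compact
          (isCompact_uIcc.prod isCompact_uIcc)).mono_set
          (Set.prod_mono Set.uIoc_subset_uIcc Set.uIoc_subset_uIcc)
    _ = (2 * π)⁻¹ * ∫ t in 0..2 * π, circleAverage (fun z => ‖F z‖ ^ p) 0 1 := by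
        rw [← intervalIntegral.integral_const_mul]
        congr 2 with t
        rw [← circleAverage_mul_left_unit (hu1 t), circleAverage, smul_eq_mul]
        simp only [mul_comm]
    _ = circleAverage (fun z => ‖F z‖ ^ p) 0 1 := by
        rw [intervalIntegral.integral_const, sub_zero, smul_eq_mul,
          inv_mul_cancel_left₀ hpos.ne']

theorem circleAverage_rpow_mono {p : ℝ} (hp : 1 ≤ p) {F : ℂ → ℂ}
    (hF : DifferentiableOn ℂ F (ball 0 1)) {r s : ℝ} (hr : 0 < r) (hrs : r ≤ s) (hs : s < 1) :
    circleAverage (fun z => ‖F z‖ ^ p) 0 r ≤ circleAverage (fun z => ‖F z‖ ^ p) 0 s := by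
  rcases hrs.lt_or_eq with hlt | rfl
  · have hs0 : 0 < s := hr.trans hlt
    have hd : DiffContOnCl ℂ (fun z => F (s * z)) (ball 0 1) := by
      refine DifferentiableOn.diffContOnCl (hF.comp (by fun_prop) fun z hz => ?_)
      rw [closure_ball _ one_ne_zero, mem_closedBall_zero_iff] at hz
      rw [mem_ball_zero_iff, norm_mul, norm_real, Real.norm_of_nonneg hs0.le]
      nlinarith [norm_nonneg z]
    have := circleAverage_rpow_le hp hd (r := r / s) (by positivity) (by rwa [div_lt_one hs0])
    rw [circleAverage_eq_circleAverage_zero_one] at this ⊢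
    rw [circleAverage_eq_circleAverage_zero_one (R := s)]
    refine le_trans (le_of_eq ?_) (this.trans (le_of_eq ?_))
    · congr 1 with z
      have : (s : ℂ) ≠ 0 := ofReal_ne_zero.2 hs0.ne'
      congr 3
      push_cast
      rw [add_zero, add_zero, ← mul_assoc, mul_div_cancel₀ _ this]
    · simp
  · exact le_rfl

/-- Invariance of the circle average under a disc automorphism. -/
theorem DiscAut.circleAverage_comp (φ : DiscAut) {h : ℂ → ℝ} (hh : ContinuousOn h (sphere 0 1)) :
    circleAverage (fun z => (1 - normSq (φ.a : ℂ)) / ‖1 - conj (φ.a : ℂ) * z‖ ^ 2 *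
      h (φ.formula z)) 0 1 = circleAverage h 0 1 := by
  have hc := continuous_comp_circleMap hh
  set d : ℝ → ℂ := fun θ => 1 - conj (φ.a : ℂ) * circleMap 0 1 θ with hd
  have hre : ∀ θ, 0 < (d θ).re := fun θ => φ.re_denominator_pos (by simp)
  have hslit : ∀ θ, d θ ∈ slitPlane := fun θ => Or.inl (hre θ)
  -- `α` lifts `φ` to angles: on the circle `φ(ζ) = lam · ζ · conj d / d`, and `conj d / d = exp(-2i
  -- · Im log d)`. The logarithm is smooth because `Re d > 0`.
  set α : ℝ → ℝ := fun θ => θ + arg (φ.lam : ℂ) - 2 * (Complex.log (d θ)).im with hα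
  set α' : ℝ → ℝ := fun θ => (1 - normSq (φ.a : ℂ)) / ‖d θ‖ ^ 2 with hα'
  have hderiv : ∀ θ, HasDerivAt α (α' θ) θ := by
    intro θ
    have h1 : HasDerivAt d (-(conj (φ.a : ℂ) * (circleMap 0 1 θ * I))) θ :=
      ((hasDerivAt_circleMap 0 1 θ).const_mul _).const_sub 1
    have h2 : HasDerivAt (fun θ => Complex.log (d θ)) _ θ := h1.clog_real (hslit θ)
    have h3 := (Complex.imCLM.hasFDerivAt (x := Complex.log (d θ))).comp_hasDerivAt θ h2
    have h4 := ((hasDerivAt_id θ).add_const (arg (φ.lam : ℂ))).sub (h3.const_mul 2)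
    refine h4.congr_deriv ?_
    have hx : normSq (conj (φ.a : ℂ) * circleMap 0 1 θ) = normSq (φ.a : ℂ) := by
      rw [map_mul, normSq_conj, normSq_eq_norm_sq (circleMap 0 1 θ)]
      simp
    have h0 : normSq (d θ) ≠ 0 := normSq_eq_zero.not.2 (slitPlane_ne_zero (hslit θ))
    simp only [hα', ← normSq_eq_norm_sq, ← hx, ← mul_assoc, imCLM_apply]
    simp only [hd] at h0 ⊢
    generalize conj (φ.a : ℂ) * circleMap 0 1 θ = x at h0 ⊢
    rw [div_im, eq_div_iff h0]
    have e : ∀ N a b : ℝ, N ≠ 0 → (1 - 2 * (a / N - b / N)) * N = N - 2 * (a - b) := by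
      intro N a b hN
      field_simp
    rw [e _ _ _ h0]
    simp [normSq_apply]
    ring
  have hmap : ∀ θ, circleMap 0 1 (α θ) = φ.formula (circleMap 0 1 θ) := by
    intro θ
    have hl : cexp (arg (φ.lam : ℂ) * I) = φ.lam := by
      have := norm_mul_exp_arg_mul_I (φ.lam : ℂ)
      rwa [Circle.norm_coe, ofReal_one, one_mul] at this
    have hd0 := slitPlane_ne_zero (hslit θ)
    have hL : (-(2 * (Complex.log (d θ)).im : ℝ) : ℂ) * I =
        conj (Complex.log (d θ)) - Complex.log (d θ) := by
      apply Complex.ext <;> simp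
      ring
    have hζ : circleMap 0 1 θ * conj (circleMap 0 1 θ) = 1 := by
      rw [Complex.mul_conj, normSq_eq_norm_sq]
      simp
    have hdc : circleMap 0 1 θ * conj (d θ) = circleMap 0 1 θ - φ.a := by
      simp only [hd, map_sub, map_mul, map_one, Complex.conj_conj]
      linear_combination -(φ.a : ℂ) * hζ
    have e1 : circleMap 0 1 (α θ) =
        cexp (θ * I) * cexp (arg (φ.lam : ℂ) * I) * cexp (-(2 * (Complex.log (d θ)).im : ℝ) * I) := by
      rw [← Complex.exp_add, ← Complex.exp_add, circleMap_zero, ofReal_one, one_mul]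
      congr 1
      simp only [hα]
      push_cast
      ring
    have e2 : cexp (θ * I) = circleMap 0 1 θ := by simp [circleMap_zero]
    rw [e1, hL, Complex.exp_sub, Complex.exp_conj, Complex.exp_log hd0, hl, e2, DiscAut.formula, ← hdc]
    simp only [hd]
    ring
  have hcont' : Continuous α' := by
    refine continuous_const.div (by fun_prop) fun θ => ?_
    exact pow_ne_zero _ (norm_ne_zero_iff.2 (slitPlane_ne_zero (hslit θ)))
  have hcv := intervalIntegral.integral_comp_mul_deriv (a := 0) (b := 2 * π)
    (fun θ _ => hderiv θ) hcont'.continuousOn hc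
  -- `d` is periodic, so `φ` winds once around the circle.
  have hper : α (2 * π) = α 0 + 2 * π := by
    simp only [hα, hd, circleMap_zero]
    simp
    ring
  rw [hper] at hcv
  have hp : Function.Periodic (fun θ : ℝ => h (circleMap 0 1 θ)) (2 * π) := fun θ => by
    simp [periodic_circleMap 0 1 θ]
  rw [hp.intervalIntegral_add_eq (α 0) 0, zero_add] at hcv
  rw [circleAverage, circleAverage, ← hcv]
  congr 2 with θ
  simp only [Function.comp, hmap, hα', hd]
  ring

/-- `F` need not extend to the circle, so it is replaced by `F(R ·)` with `R < 1`. There one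
enlarges `r` to 1 and changes variables; then `R → 1` with `r` fixed. -/
theorem DiscAut.circleAverage_weight_mul_comp_le {p : ℝ} (hp : 1 ≤ p) (φ : DiscAut) {F : ℂ → ℂ}
    (hF : DifferentiableOn ℂ F (ball 0 1)) {A : ℝ}
    (hA : ∀ R ∈ Set.Ioo (0 : ℝ) 1, circleAverage (fun z => ‖F z‖ ^ p) 0 R ≤ A)
    {r : ℝ} (hr : r ∈ Set.Ioo (0 : ℝ) 1) :
    circleAverage (fun z => ‖φ.weight p z * F (φ.formula z)‖ ^ p) 0 r ≤ A := by
  have hp0 : 0 ≤ p := by linarith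
  have hball : ∀ {R : ℝ} {z : ℂ}, 0 ≤ R → R < 1 → ‖z‖ ≤ 1 → (R : ℂ) * z ∈ ball (0 : ℂ) 1 := by
    intro R z h0 h1 hz
    rw [mem_ball_zero_iff, norm_mul, norm_real, Real.norm_of_nonneg h0]
    nlinarith [norm_nonneg z]
  have hdil : ∀ R ∈ Set.Ioo (0 : ℝ) 1,
      circleAverage (fun z => ‖φ.weight p z * F (R * φ.formula z)‖ ^ p) 0 r ≤ A := by
    intro R hR
    have hd : DiffContOnCl ℂ (fun z => F (R * z)) (ball 0 1) := by
      refine DifferentiableOn.diffContOnCl (hF.comp (by fun_prop) fun z hz => ?_)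
      rw [closure_ball _ one_ne_zero, mem_closedBall_zero_iff] at hz
      exact hball hR.1.le hR.2 hz
    have hw : DiffContOnCl ℂ (φ.weight p) (ball 0 1) := by
      refine DifferentiableOn.diffContOnCl fun z hz => ?_
      rw [closure_ball _ one_ne_zero, mem_closedBall_zero_iff] at hz
      exact (φ.differentiableAt_weight p hz).differentiableWithinAt
    refine (circleAverage_rpow_le hp (hw.smul (φ.diffContOnCl_comp hd)) hr.1.le hr.2).trans ?_
    have hcont : ContinuousOn (fun z => ‖F (R * z)‖ ^ p) (sphere 0 1) := by
      refine (ContinuousOn.norm (hd.continuousOn.mono ?_)).rpow_const fun _ _ => Or.inr hp0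
      rw [closure_ball _ one_ne_zero]
      exact sphere_subset_closedBall
    have := φ.circleAverage_comp hcont
    have hAR := hA R hR
    rw [circleAverage_eq_circleAverage_zero_one] at hAR
    simp only [add_zero] at hAR
    rw [← this] at hAR
    simpa only [smul_eq_mul, norm_mul, Real.mul_rpow (norm_nonneg _) (norm_nonneg _),
      φ.norm_weight_rpow hp] using hAR
  have hcm : ∀ θ, ‖circleMap 0 r θ‖ < 1 := fun θ => by
    simpa [abs_of_pos hr.1] using hr.2
  -- `R = 1` is allowed, since `φ` maps the circle of radius `r < 1` into the open disc.
  have hcont : Continuous fun R : Set.Icc (0 : ℝ) 1 =>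
      circleAverage (fun z => ‖φ.weight p z * F ((R : ℝ) * φ.formula z)‖ ^ p) 0 r := by
    simp only [circleAverage]
    refine (intervalIntegral.continuous_parametric_intervalIntegral_of_continuous' (μ := volume)
      (f := fun (R : Set.Icc (0 : ℝ) 1) θ => ‖φ.weight p (circleMap 0 r θ) *
        F (((R : ℝ) : ℂ) * φ.formula (circleMap 0 r θ))‖ ^ p) ?_ 0 (2 * π)).const_smul (2 * π)⁻¹
    refine (Continuous.norm ?_).rpow_const fun _ => Or.inr hp0
    have hφc : Continuous fun x : Set.Icc (0 : ℝ) 1 × ℝ => φ.formula (circleMap 0 r x.2) :=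
      ContinuousOn.comp_continuous (s := ball 0 1) (fun z hz => (φ.differentiableAt_formula
        (mem_ball_zero_iff.1 hz).le).continuousAt.continuousWithinAt) (by fun_prop)
        fun x => mem_ball_zero_iff.2 (hcm x.2)
    have hwc : Continuous fun x : Set.Icc (0 : ℝ) 1 × ℝ => φ.weight p (circleMap 0 r x.2) :=
      ContinuousOn.comp_continuous (s := ball 0 1) (fun z hz => (φ.differentiableAt_weight p
        (mem_ball_zero_iff.1 hz).le).continuousAt.continuousWithinAt) (by fun_prop)
        fun x => mem_ball_zero_iff.2 (hcm x.2)
    refine hwc.mul (hF.continuousOn.comp_continuous (Continuous.mul (by fun_prop) hφc) fun x => ?_)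
    have h1 := φ.norm_formula_lt_one' (hcm x.2)
    have h2 := x.1.2
    rw [mem_ball_zero_iff, norm_mul, norm_real, Real.norm_of_nonneg h2.1]
    nlinarith [h2.1, h2.2, norm_nonneg (φ.formula (circleMap 0 r x.2))]
  have hcl : IsClosed {R : Set.Icc (0 : ℝ) 1 |
      circleAverage (fun z => ‖φ.weight p z * F ((R : ℝ) * φ.formula z)‖ ^ p) 0 r ≤ A} :=
    isClosed_le hcont continuous_const
  have hmem : (⟨1, by simp⟩ : Set.Icc (0 : ℝ) 1) ∈ {R : Set.Icc (0 : ℝ) 1 |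
      circleAverage (fun z => ‖φ.weight p z * F ((R : ℝ) * φ.formula z)‖ ^ p) 0 r ≤ A} := by
    let x : ℕ → Set.Icc (0 : ℝ) 1 := fun n =>
      ⟨1 - 1 / ((n : ℝ) + 2), by
        rw [Set.mem_Icc, sub_nonneg, div_le_one (by positivity)]
        exact ⟨by linarith [n.cast_nonneg (α := ℝ)], sub_le_self _ (by positivity)⟩⟩
    refine hcl.mem_of_tendsto (b := atTop) (f := x) ?_ (Eventually.of_forall fun n => ?_)
    · rw [tendsto_subtype_rng]
      have h := (tendsto_one_div_add_atTop_nhds_zero_nat (𝕜 := ℝ)).comp (tendsto_add_atTop_nat 1)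
      have h' := h.const_sub 1
      rw [sub_zero] at h'
      refine h'.congr fun n => ?_
      simp only [Function.comp, x]
      push_cast
      ring
    · refine hdil _ ⟨?_, ?_⟩
      · rw [sub_pos, div_lt_one (by positivity)]
        linarith [n.cast_nonneg (α := ℝ)]
      · exact sub_lt_self _ (by positivity)
  simpa using hmem

/-! ### Integral means and membership in the Hardy space. -/

theorem zeroExt_of_norm_lt (f : 𝔻 → ℂ) {z : ℂ} (hz : ‖z‖ < 1) :
    zeroExt f z = f (UnitDisc.mk z hz) :=
  zeroExt_coe f (UnitDisc.mk z hz)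

theorem isAnalytic_of_eq {f : 𝔻 → ℂ} {F : ℂ → ℂ} (hF : DifferentiableOn ℂ F (ball 0 1))
    (h : ∀ z : 𝔻, f z = F z) : IsAnalytic f := by
  refine DifferentiableOn.congr hF fun z hz => ?_
  rw [zeroExt_of_norm_lt f (mem_ball_zero_iff.1 hz), h, UnitDisc.coe_mk]

theorem integralMean_congr_norm {f g : 𝔻 → ℂ} (p : ℝ) (h : ∀ z, ‖f z‖ = ‖g z‖) :
    integralMean p f = integralMean p g := by
  have : ∀ z, ‖zeroExt f z‖ = ‖zeroExt g z‖ := fun z => by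
    by_cases hz : ∃ w : 𝔻, (w : ℂ) = z
    · obtain ⟨w, rfl⟩ := hz
      simp only [zeroExt_coe, h]
    · simp [zeroExt, Function.extend_apply' _ _ _ hz]
  funext r
  simp only [integralMean, this]

theorem integralMean_eq_circleAverage {f : 𝔻 → ℂ} {F : ℂ → ℂ} (p : ℝ) (h : ∀ z : 𝔻, f z = F z)
    {r : ℝ} (hr : r ∈ Set.Ioo (0 : ℝ) 1) :
    integralMean p f r = circleAverage (fun z => ‖F z‖ ^ p) 0 r := by
  refine circleAverage_congr_sphere fun z hz => ?_
  have hz' : ‖z‖ < 1 := by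
    rw [mem_sphere_zero_iff_norm, abs_of_pos hr.1] at hz
    exact hz ▸ hr.2
  simp only [zeroExt_of_norm_lt f hz', h, UnitDisc.coe_mk]

theorem integralMean_le_of_norm_le {p : ℝ} (hp : 1 ≤ p) {f g : 𝔻 → ℂ} (hf : IsAnalytic f)
    (hg : IsAnalytic g) {r : ℝ} (hr : r ∈ Set.Ioo (0 : ℝ) 1) {c : ℝ} (hc : 0 ≤ c)
    (h : ∀ z : 𝔻, ‖(z : ℂ)‖ = r → ‖f z‖ ≤ c * ‖g z‖) :
    integralMean p f r ≤ c ^ p * integralMean p g r := by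
  have hp0 : 0 ≤ p := by linarith
  rw [integralMean, integralMean, ← smul_eq_mul, ← circleAverage_smul]
  refine circleAverage_mono (hf.circleIntegrable hp0 hr) ((hg.circleIntegrable hp0 hr).const_smul)
    fun z hz => ?_
  rw [mem_sphere_zero_iff_norm, abs_of_pos hr.1] at hz
  have hz' : ‖z‖ < 1 := hz ▸ hr.2
  simp only [Pi.smul_apply, smul_eq_mul, zeroExt_of_norm_lt _ hz']
  rw [← Real.mul_rpow hc (norm_nonneg _)]
  exact Real.rpow_le_rpow (norm_nonneg _) (h _ hz) hp0

theorem integralMean_mono {p : ℝ} (hp : 1 ≤ p) {f : 𝔻 → ℂ} (hf : IsAnalytic f) {r s : ℝ}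
    (hr : 0 < r) (hrs : r ≤ s) (hs : s < 1) : integralMean p f r ≤ integralMean p f s :=
  circleAverage_rpow_mono hp hf hr hrs hs

/-- The `p`-th power of the Hardy norm. -/
def normPow (p : ℝ) (f : 𝔻 → ℂ) : ℝ := sSup (integralMean p f '' Set.Ioo 0 1)

theorem MemHp.integralMean_le {p : ℝ} {f : 𝔻 → ℂ} (hf : MemHp p f) {r : ℝ}
    (hr : r ∈ Set.Ioo (0 : ℝ) 1) : integralMean p f r ≤ normPow p f :=
  le_csSup hf.2 ⟨r, hr, rfl⟩

theorem IsAnalytic.memHp {p : ℝ} {f : 𝔻 → ℂ} (hf : IsAnalytic f) {A : ℝ}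
    (h : ∀ r ∈ Set.Ioo (0 : ℝ) 1, integralMean p f r ≤ A) : MemHp p f :=
  ⟨hf, A, by rintro _ ⟨r, hr, rfl⟩; exact h r hr⟩

theorem normPow_le {p : ℝ} {f : 𝔻 → ℂ} {A : ℝ}
    (h : ∀ r ∈ Set.Ioo (0 : ℝ) 1, integralMean p f r ≤ A) : normPow p f ≤ A :=
  csSup_le ⟨_, 1 / 2, by norm_num, rfl⟩ (by rintro _ ⟨r, hr, rfl⟩; exact h r hr)

theorem memHp_of_bounded {p : ℝ} (hp : 1 ≤ p) {f : 𝔻 → ℂ} (hf : IsAnalytic f) {C : ℝ}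
    (h : ∀ z, ‖f z‖ ≤ C) : MemHp p f := by
  refine hf.memHp (A := C ^ p) fun r hr => ?_
  refine circleAverage_mono_on_of_le_circle (hf.circleIntegrable (by linarith) hr) fun z hz => ?_
  rw [mem_sphere_zero_iff_norm, abs_of_pos hr.1] at hz
  rw [zeroExt_of_norm_lt _ (hz ▸ hr.2)]
  exact Real.rpow_le_rpow (norm_nonneg _) (h _) (by linarith)

/-! ### The operator `U` -/

theorem U_apply (p : ℝ) (φ : DiscAut) (f : 𝔻 → ℂ) (z : 𝔻) :
    U p φ f z = φ.weight p z * f (φ z) := by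
  have h := φ.conj_lam_mul_deriv_formula z.norm_lt_one.le
  simp only [U, mulOp, compOp, Module.End.mul_apply, LinearMap.mulLeft_apply, Pi.mul_apply,
    LinearMap.funLeft_apply, h]
  rfl

theorem DiscAut.differentiableOn_zeroExt_comp {f : 𝔻 → ℂ} (hf : IsAnalytic f) (φ : DiscAut) :
    DifferentiableOn ℂ (fun z => zeroExt f (φ.formula z)) (ball 0 1) :=
  hf.comp (fun _ hz => (φ.differentiableAt_formula
    (mem_ball_zero_iff.1 hz).le).differentiableWithinAt) fun _ hz =>
    mem_ball_zero_iff.2 (φ.norm_formula_lt_one' (mem_ball_zero_iff.1 hz))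

theorem DiscAut.differentiableOn_weight (p : ℝ) (φ : DiscAut) :
    DifferentiableOn ℂ (φ.weight p) (ball 0 1) := fun _ hz =>
  (φ.differentiableAt_weight p (mem_ball_zero_iff.1 hz).le).differentiableWithinAt

theorem U_apply_zeroExt (p : ℝ) (φ : DiscAut) (f : 𝔻 → ℂ) (z : 𝔻) :
    U p φ f z = φ.weight p z * zeroExt f (φ.formula z) := by
  rw [U_apply, ← DiscAut.coe_apply, zeroExt_coe]

theorem isAnalytic_U (p : ℝ) (φ : DiscAut) {f : 𝔻 → ℂ} (hf : IsAnalytic f) :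
    IsAnalytic (U p φ f) :=
  isAnalytic_of_eq ((φ.differentiableOn_weight p).mul (φ.differentiableOn_zeroExt_comp hf))
    (U_apply_zeroExt p φ f)

theorem integralMean_U_le {p : ℝ} (hp : 1 ≤ p) (φ : DiscAut) {f : 𝔻 → ℂ} (hf : MemHp p f)
    {r : ℝ} (hr : r ∈ Set.Ioo (0 : ℝ) 1) : integralMean p (U p φ f) r ≤ normPow p f := by
  rw [integralMean_eq_circleAverage (F := fun z => φ.weight p z * zeroExt f (φ.formula z)) p
    (U_apply_zeroExt p φ f) hr]
  exact φ.circleAverage_weight_mul_comp_le hp hf.1 (fun R hR => hf.integralMean_le hR) hr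

theorem memHp_U {p : ℝ} (hp : 1 ≤ p) (φ : DiscAut) {f : 𝔻 → ℂ} (hf : MemHp p f) :
    MemHp p (U p φ f) :=
  (isAnalytic_U p φ hf.1).memHp fun _ hr => integralMean_U_le hp φ hf hr

/-- The chain rule for `φ ∘ φ⁻¹ = id`. Working with moduli avoids comparing branches of the power.
-/
theorem DiscAut.norm_weight_inv_mul {p : ℝ} (hp : 1 ≤ p) (φ : DiscAut) (z : 𝔻) :
    ‖φ.inv.weight p z‖ * ‖φ.weight p (φ.inv z)‖ = 1 := by
  have hz := z.norm_lt_one.le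
  have h0 := φ.inv.denominator_ne_zero hz
  have hl := φ.conj_lam_mul_lam
  have hN := φ.one_sub_normSq_pos
  have key : (1 - conj (φ.inv.a : ℂ) * z) * (1 - conj (φ.a : ℂ) * φ.inv.formula z) =
      (1 - normSq (φ.a : ℂ) : ℝ) := by
    rw [formula, mul_sub, mul_div_assoc', mul_div_cancel₀ _ h0]
    push_cast
    rw [← Complex.mul_conj, coe_inv_lam, coe_inv_a]
    simp only [map_neg, map_mul]
    linear_combination -(φ.a : ℂ) * conj (φ.a : ℂ) * hl
  have ha : normSq (φ.inv.a : ℂ) = normSq (φ.a : ℂ) := by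
    rw [coe_inv_a, normSq_neg, normSq_mul, Circle.normSq_coe, one_mul]
  have hk := congrArg (‖·‖ ^ 2) key
  simp only [norm_mul, norm_real, mul_pow] at hk
  have hpow : (‖φ.inv.weight p z‖ * ‖φ.weight p (φ.inv z)‖) ^ p = 1 := by
    rw [Real.mul_rpow (norm_nonneg _) (norm_nonneg _), norm_weight_rpow hp, norm_weight_rpow hp,
      ha, coe_apply, div_mul_div_comm, hk, Real.norm_of_nonneg hN.le, ← pow_two]
    exact div_self (pow_ne_zero _ hN.ne')
  exact (Real.rpow_left_inj (by positivity) zero_le_one (by linarith)).1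
    (hpow.trans (Real.one_rpow p).symm)

theorem norm_U_inv_U {p : ℝ} (hp : 1 ≤ p) (φ : DiscAut) (f : 𝔻 → ℂ) (z : 𝔻) :
    ‖U p φ.inv (U p φ f) z‖ = ‖f z‖ := by
  rw [U_apply, U_apply, φ.apply_inv_apply, norm_mul, norm_mul, ← mul_assoc,
    φ.norm_weight_inv_mul hp, one_mul]

theorem normPow_U {p : ℝ} (hp : 1 ≤ p) (φ : DiscAut) {f : 𝔻 → ℂ} (hf : MemHp p f) :
    normPow p (U p φ f) = normPow p f := by
  refine le_antisymm (normPow_le fun r hr => integralMean_U_le hp φ hf hr) ?_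
  refine normPow_le fun r hr => ?_
  rw [← integralMean_congr_norm p (norm_U_inv_U hp φ f)]
  exact integralMean_U_le hp φ.inv (memHp_U hp φ hf) hr

/-- The preimage is obtained by solving the weighted equation pointwise; its modulus is that of `U p
φ.inv g`, which supplies the `H^p` bound. -/
theorem exists_U_eq {p : ℝ} (hp : 1 ≤ p) (φ : DiscAut) {g : 𝔻 → ℂ} (hg : MemHp p g) :
    ∃ f, MemHp p f ∧ U p φ f = g := by
  refine ⟨fun z => g (φ.inv z) / φ.weight p (φ.inv z), ?_, ?_⟩
  · have hnorm : ∀ z, ‖g (φ.inv z) / φ.weight p (φ.inv z)‖ = ‖U p φ.inv g z‖ := fun z => by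
      have h0 : ‖φ.weight p (φ.inv z)‖ ≠ 0 :=
        norm_ne_zero_iff.2 (φ.weight_ne_zero p (φ.inv z).norm_lt_one.le)
      rw [U_apply, norm_div, norm_mul, div_eq_iff h0, mul_right_comm, φ.norm_weight_inv_mul hp,
        one_mul]
    refine IsAnalytic.memHp (A := normPow p g) ?_ fun r hr => ?_
    · refine isAnalytic_of_eq (F := fun z => zeroExt g (φ.inv.formula z) /
        φ.weight p (φ.inv.formula z)) ?_ fun z => by rw [← DiscAut.coe_apply, zeroExt_coe]
      refine (φ.inv.differentiableOn_zeroExt_comp hg.1).div (fun z hz => ?_) fun z hz =>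
        φ.weight_ne_zero p (φ.inv.norm_formula_le_one (mem_ball_zero_iff.1 hz).le)
      have hz' := (mem_ball_zero_iff.1 hz).le
      exact ((φ.differentiableAt_weight p (φ.inv.norm_formula_le_one hz')).comp z
        (φ.inv.differentiableAt_formula hz')).differentiableWithinAt
    · rw [integralMean_congr_norm p hnorm]
      exact integralMean_U_le hp φ.inv hg hr
  · funext z
    rw [U_apply, φ.inv_apply_apply, mul_div_cancel₀ _ (φ.weight_ne_zero p z.norm_lt_one.le)]

/-- Point evaluation at 0 is bounded by the sub-mean value property on any circle (radius 1/2 here).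
The isometry `U` of an automorphism with `φ 0 = z` transports this to `z`, and its weight at 0
supplies the factor `1 - |z|²`. -/
theorem one_sub_sq_mul_norm_rpow_le {p : ℝ} (hp : 1 ≤ p) {f : 𝔻 → ℂ} (hf : MemHp p f) (z : 𝔻) :
    (1 - normSq (z : ℂ)) * ‖f z‖ ^ p ≤ normPow p f := by
  let φ : DiscAut := ⟨1, -z⟩
  have hφ : φ 0 = z := by
    rw [← UnitDisc.coe_inj, DiscAut.coe_apply]
    simp [φ, DiscAut.formula]
  have hU := memHp_U hp φ hf
  have hr : (1 / 2 : ℝ) ∈ Set.Ioo (0 : ℝ) 1 := by norm_num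
  have hd : DiffContOnCl ℂ (fun z => zeroExt (U p φ f) ((1 / 2 : ℝ) * z)) (ball 0 1) := by
    refine DifferentiableOn.diffContOnCl (hU.1.comp (by fun_prop) fun z hz => ?_)
    rw [closure_ball _ one_ne_zero, mem_closedBall_zero_iff] at hz
    rw [mem_ball_zero_iff, norm_mul, norm_real, Real.norm_of_nonneg hr.1.le]
    linarith
  have h1 := norm_rpow_le_circleAverage hp hd
  have h2 := hU.integralMean_le hr
  rw [integralMean, circleAverage_eq_circleAverage_zero_one, normPow_U hp φ hf] at h2
  simp only [add_zero] at h2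
  refine le_trans (le_of_eq ?_) (h1.trans h2)
  rw [mul_zero, ← UnitDisc.coe_zero, zeroExt_coe, U_apply, hφ, norm_mul,
    Real.mul_rpow (norm_nonneg _) (norm_nonneg _), φ.norm_weight_rpow hp]
  simp [φ]

/-! ### Multiplication by a disc automorphism -/

theorem DiscAut.isAnalytic_mul (ψ : DiscAut) {f : 𝔻 → ℂ} (hf : IsAnalytic f) :
    IsAnalytic fun z => (ψ z : ℂ) * f z := by
  refine isAnalytic_of_eq (F := fun z => ψ.formula z * zeroExt f z)
    (DifferentiableOn.mul (fun z hz => ?_) hf) fun z => by rw [zeroExt_coe, DiscAut.coe_apply]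
  exact (ψ.differentiableAt_formula (mem_ball_zero_iff.1 hz).le).differentiableWithinAt

theorem DiscAut.exists_le_norm (ψ : DiscAut) {c : ℝ} (hc0 : 0 ≤ c) (hc : c < 1) :
    ∃ s ∈ Set.Ioo (0 : ℝ) 1, ∀ z : 𝔻, s ≤ ‖(z : ℂ)‖ → c ≤ ‖(ψ z : ℂ)‖ := by
  set K : ℝ := (1 - ‖(ψ.a : ℂ)‖ ^ 2) / (1 - ‖(ψ.a : ℂ)‖) ^ 2
  have ha := ψ.a.norm_lt_one
  have hK1 : 0 < 1 - ‖(ψ.a : ℂ)‖ ^ 2 := by nlinarith [norm_nonneg (ψ.a : ℂ)]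
  have hK : 0 ≤ K := by positivity
  have ht : Tendsto (fun s : ℝ => K * (1 - s ^ 2)) (𝓝[<] 1) (𝓝 0) := by
    have : Continuous fun s : ℝ => K * (1 - s ^ 2) := by fun_prop
    simpa using (this.tendsto 1).mono_left nhdsWithin_le_nhds
  have hev := (ht.eventually_lt_const (u := 1 - c ^ 2) (by nlinarith)).and
    (Ioo_mem_nhdsLT (zero_lt_one' ℝ))
  obtain ⟨s, hs, hs01⟩ := hev.exists
  refine ⟨s, hs01, fun z hz => ?_⟩
  have h := ψ.one_sub_norm_formula_sq z.norm_lt_one.le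
  have hden : 1 - ‖(ψ.a : ℂ)‖ ≤ ‖1 - conj (ψ.a : ℂ) * z‖ := by
    have h1 := norm_sub_norm_le (1 : ℂ) (conj (ψ.a : ℂ) * z)
    rw [norm_one, norm_mul, RCLike.norm_conj] at h1
    nlinarith [z.norm_lt_one, norm_nonneg (ψ.a : ℂ)]
  have hle : 1 - ‖ψ.formula z‖ ^ 2 ≤ K * (1 - s ^ 2) := by
    rw [h, div_mul_eq_mul_div]
    have hz1 := z.norm_lt_one
    have : 0 ≤ 1 - ‖(z : ℂ)‖ ^ 2 := by nlinarith [norm_nonneg (z : ℂ)]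
    have hs1 := hs01.1
    have hs2 : 0 ≤ 1 - s ^ 2 := by nlinarith [hs01.2]
    have ha' := sub_pos.2 ha
    gcongr
  rw [coe_apply]
  exact le_of_sq_le_sq (by linarith) (norm_nonneg _)

/-- On circles close to the boundary `|ψ| ≥ c`, so dividing by `ψ` costs at most `c⁻¹`. Monotonicity
of the means carries the bound back to radius `r`, and `c → 1` removes the constant. -/
theorem DiscAut.integralMean_le_of_mul {p : ℝ} (hp : 1 ≤ p) (ψ : DiscAut) {f : 𝔻 → ℂ}
    (hf : IsAnalytic f) {A : ℝ}
    (hA : ∀ r ∈ Set.Ioo (0 : ℝ) 1, integralMean p (fun z => (ψ z : ℂ) * f z) r ≤ A) {r : ℝ}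
    (hr : r ∈ Set.Ioo (0 : ℝ) 1) : integralMean p f r ≤ A := by
  have hc : ∀ c ∈ Set.Ioo (0 : ℝ) 1, c ^ p * integralMean p f r ≤ A := by
    intro c hc
    obtain ⟨s, hs, hsψ⟩ := ψ.exists_le_norm hc.1.le hc.2
    have ht : max r s ∈ Set.Ioo (0 : ℝ) 1 := ⟨lt_max_of_lt_left hr.1, max_lt hr.2 hs.2⟩
    have h1 := integralMean_mono hp hf hr.1 (le_max_left r s) ht.2
    have h2 := integralMean_le_of_norm_le hp hf (ψ.isAnalytic_mul hf) ht (inv_pos.2 hc.1).le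
      fun z hz => by
        rw [norm_mul, ← div_eq_inv_mul, le_div_iff₀ hc.1, mul_comm]
        exact mul_le_mul_of_nonneg_right (hsψ z (hz ▸ le_max_right r s)) (norm_nonneg _)
    have hcp : 0 < c ^ p := Real.rpow_pos_of_pos hc.1 p
    rw [Real.inv_rpow hc.1.le] at h2
    have h3 := h1.trans (h2.trans (mul_le_mul_of_nonneg_left (hA _ ht) (inv_pos.2 hcp).le))
    rwa [← div_eq_inv_mul, le_div_iff₀ hcp, mul_comm] at h3
  have ht : Tendsto (fun c : ℝ => c ^ p * integralMean p f r) (𝓝[<] 1)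
      (𝓝 (1 ^ p * integralMean p f r)) :=
    ((Real.continuousAt_rpow_const 1 p (Or.inl one_ne_zero)).mul
      continuousAt_const).mono_left nhdsWithin_le_nhds
  rw [Real.one_rpow, one_mul] at ht
  exact le_of_tendsto ht (eventually_of_mem (Ioo_mem_nhdsLT (zero_lt_one' ℝ)) hc)

theorem DiscAut.integralMean_mul_le {p : ℝ} (hp : 1 ≤ p) (ψ : DiscAut) {f : 𝔻 → ℂ}
    (hf : IsAnalytic f) {r : ℝ} (hr : r ∈ Set.Ioo (0 : ℝ) 1) :
    integralMean p (fun z => (ψ z : ℂ) * f z) r ≤ integralMean p f r := by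
  simpa using integralMean_le_of_norm_le hp (ψ.isAnalytic_mul hf) hf hr zero_le_one fun z _ => by
    rw [norm_mul]
    exact mul_le_mul_of_nonneg_right (ψ z).norm_lt_one.le (norm_nonneg _)

theorem DiscAut.memHp_mul_iff {p : ℝ} (hp : 1 ≤ p) (ψ : DiscAut) {f : 𝔻 → ℂ}
    (hf : IsAnalytic f) : MemHp p (fun z => (ψ z : ℂ) * f z) ↔ MemHp p f :=
  ⟨fun h => hf.memHp fun _ hr => ψ.integralMean_le_of_mul hp hf (fun _ => h.integralMean_le) hr,
    fun h => (ψ.isAnalytic_mul hf).memHp fun _ hr =>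
      (ψ.integralMean_mul_le hp hf hr).trans (h.integralMean_le hr)⟩

theorem DiscAut.normPow_mul {p : ℝ} (hp : 1 ≤ p) (ψ : DiscAut) {f : 𝔻 → ℂ} (hf : MemHp p f) :
    normPow p (fun z => (ψ z : ℂ) * f z) = normPow p f :=
  le_antisymm
    (normPow_le fun _ hr => (ψ.integralMean_mul_le hp hf.1 hr).trans (hf.integralMean_le hr))
    (normPow_le fun _ hr => ψ.integralMean_le_of_mul hp hf.1
      (fun _ => ((ψ.memHp_mul_iff hp hf.1).2 hf).integralMean_le) hr)

theorem DiscAut.exists_mul_eq {p : ℝ} (hp : 1 ≤ p) (ψ : DiscAut) {g : 𝔻 → ℂ} (hg : MemHp p g)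
    (h0 : g ψ.a = 0) : ∃ f, MemHp p f ∧ (fun z => (ψ z : ℂ) * f z) = g := by
  -- The quotient `g / ψ`, with its removable singularity at `ψ.a` filled in by `dslope`.
  set f : 𝔻 → ℂ := fun z => dslope (zeroExt g) ψ.a z * (1 - conj (ψ.a : ℂ) * z) / ψ.lam with hf
  have hfa : IsAnalytic f := by
    refine isAnalytic_of_eq (F := fun z => dslope (zeroExt g) ψ.a z *
      (1 - conj (ψ.a : ℂ) * z) / ψ.lam) ?_ fun z => rfl
    refine DifferentiableOn.div_const (DifferentiableOn.mul ?_ (by fun_prop)) _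
    exact (Complex.differentiableOn_dslope
      (isOpen_ball.mem_nhds (mem_ball_zero_iff.2 ψ.a.norm_lt_one))).2 hg.1
  have hfg : (fun z => (ψ z : ℂ) * f z) = g := by
    funext z
    have h1 := sub_smul_dslope (zeroExt g) ψ.a z
    rw [zeroExt_coe, zeroExt_coe, h0, sub_zero, smul_eq_mul] at h1
    have hd := ψ.denominator_ne_zero z.norm_lt_one.le
    have hl : (ψ.lam : ℂ) ≠ 0 := Circle.coe_ne_zero _
    rw [← h1, DiscAut.coe_apply, DiscAut.formula, hf, mul_div_assoc', div_mul_eq_mul_div,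
      div_div, div_eq_iff (mul_ne_zero hd hl)]
    ring
  exact ⟨f, (ψ.memHp_mul_iff hp hfa).1 (hfg ▸ hg), hfg⟩

/-! ### The operator `S`: isometry, range and powers. -/

theorem S_eq (p : ℝ) (ψ φ : DiscAut) (f : 𝔻 → ℂ) :
    S p ψ φ f = fun z => (ψ z : ℂ) * U p φ f z := rfl

theorem S_apply (p : ℝ) (ψ φ : DiscAut) (f : 𝔻 → ℂ) (z : 𝔻) :
    S p ψ φ f z = (ψ z : ℂ) * U p φ f z := rfl

theorem memHp_S {p : ℝ} (hp : 1 ≤ p) (ψ φ : DiscAut) {f : 𝔻 → ℂ} (hf : MemHp p f) :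
    MemHp p (S p ψ φ f) :=
  (ψ.memHp_mul_iff hp (isAnalytic_U p φ hf.1)).2 (memHp_U hp φ hf)

theorem normPow_S {p : ℝ} (hp : 1 ≤ p) (ψ φ : DiscAut) {f : 𝔻 → ℂ} (hf : MemHp p f) :
    normPow p (S p ψ φ f) = normPow p f := by
  rw [S_eq, ψ.normPow_mul hp (memHp_U hp φ hf), normPow_U hp φ hf]

/-- The range of `S` consists of the functions in `H^p` vanishing at the zero of `ψ`. -/
theorem mem_map_S_iff {p : ℝ} (hp : 1 ≤ p) (ψ φ : DiscAut) {g : 𝔻 → ℂ} (hg : g ∈ Hp p hp) :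
    g ∈ (Hp p hp).map (S p ψ φ) ↔ g ψ.a = 0 := by
  refine ⟨?_, fun h0 => ?_⟩
  · rintro ⟨f, -, rfl⟩
    rw [S_apply, (ψ.apply_eq_zero_iff ψ.a).2 rfl, UnitDisc.coe_zero, zero_mul]
  · obtain ⟨h, hh, rfl⟩ := ψ.exists_mul_eq hp hg h0
    obtain ⟨f, hf, rfl⟩ := exists_U_eq hp φ hh
    exact ⟨f, hf, rfl⟩

theorem isCodimOneIsometry_S {p : ℝ} (hp : 1 ≤ p) (ψ φ : DiscAut) :
    IsCodimOneIsometry p hp (S p ψ φ) := by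
  refine ⟨fun f hf => ⟨memHp_S hp ψ φ hf, ?_⟩, ?_⟩
  · change normPow p (S p ψ φ f) ^ (1 / p) = normPow p f ^ (1 / p)
    rw [normPow_S hp ψ φ hf]
  · let ev : Hp p hp →ₗ[ℂ] ℂ := (LinearMap.proj ψ.a).comp (Hp p hp).subtype
    have hker : ((Hp p hp).map (S p ψ φ)).submoduleOf (Hp p hp) = LinearMap.ker ev := by
      ext g
      exact mem_map_S_iff hp ψ φ g.2
    have hsurj : Function.Surjective ev := fun c =>
      ⟨⟨fun _ => c, memHp_of_bounded hp (isAnalytic_of_eq (F := fun _ => c)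
        (differentiableOn_const c) fun _ => rfl) (C := ‖c‖) fun _ => le_rfl⟩, rfl⟩
    rw [hker, (ev.quotKerEquivOfSurjective hsurj).finrank_eq, Module.finrank_self]

theorem memHp_pow {p : ℝ} {T : Module.End ℂ (𝔻 → ℂ)} (hT : ∀ f, MemHp p f → MemHp p (T f))
    (n : ℕ) {f : 𝔻 → ℂ} (hf : MemHp p f) : MemHp p ((T ^ n) f) := by
  induction n with
  | zero => exact hf
  | succ n ih =>
    rw [pow_succ', Module.End.mul_apply]
    exact hT _ ih

theorem normPow_pow {p : ℝ} {T : Module.End ℂ (𝔻 → ℂ)} (hT : ∀ f, MemHp p f → MemHp p (T f))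
    (hN : ∀ f, MemHp p f → normPow p (T f) = normPow p f) (n : ℕ) {f : 𝔻 → ℂ} (hf : MemHp p f) :
    normPow p ((T ^ n) f) = normPow p f := by
  induction n with
  | zero => rfl
  | succ n ih => rw [pow_succ', Module.End.mul_apply, hN _ (memHp_pow hT n hf), ih]

theorem exists_U_pow_eq {p : ℝ} (hp : 1 ≤ p) (φ : DiscAut) (n : ℕ) {g : 𝔻 → ℂ}
    (hg : MemHp p g) : ∃ f, MemHp p f ∧ (U p φ ^ n) f = g := by
  induction n generalizing g with
  | zero => exact ⟨g, hg, rfl⟩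
  | succ n ih =>
    obtain ⟨h, hh, rfl⟩ := exists_U_eq hp φ hg
    obtain ⟨f, hf, rfl⟩ := ih hh
    exact ⟨f, hf, by rw [pow_succ', Module.End.mul_apply]⟩

/-- Each new application of `S` composes the earlier factors with `φ`, shifting their indices by
one, and puts `ψ` in front. -/
theorem S_pow_apply (p : ℝ) (ψ φ : DiscAut) (n : ℕ) (g : 𝔻 → ℂ) (z : 𝔻) :
    (S p ψ φ ^ n) g z = (∏ k ∈ Finset.range n, (ψ (φ^[k] z) : ℂ)) * (U p φ ^ n) g z := by
  induction n generalizing z with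
  | zero => simp
  | succ n ih =>
    rw [pow_succ', Module.End.mul_apply, S_apply, U_apply, ih, pow_succ', Module.End.mul_apply,
      U_apply, Finset.prod_range_succ']
    simp only [Function.iterate_succ_apply, Function.iterate_zero, id]
    ring

theorem DiscAut.exists_comp_iterate (ψ φ : DiscAut) (k : ℕ) :
    ∃ χ : DiscAut, ∀ z : 𝔻, χ z = ψ (φ^[k] z) := by
  induction k with
  | zero => exact ⟨ψ, fun _ => rfl⟩
  | succ k ih =>
    obtain ⟨χ, hχ⟩ := ih
    obtain ⟨χ', hχ'⟩ := exists_comp χ φ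
    exact ⟨χ', fun z => by rw [hχ', hχ, Function.iterate_succ_apply]⟩

/-! ### The non-Blaschke case -/

/-- Compare factor by factor through `x ≤ exp(-(1 - x))`. -/
theorem tendsto_prod_zero_of_not_summable {x : ℕ → ℝ} (h0 : ∀ k, 0 ≤ x k) (h1 : ∀ k, x k ≤ 1)
    (hx : ¬ Summable fun k => 1 - x k) :
    Tendsto (fun n => ∏ k ∈ Finset.range n, x k) atTop (𝓝 0) := by
  have ht := (not_summable_iff_tendsto_nat_atTop_of_nonneg fun k => sub_nonneg.2 (h1 k)).1 hx
  refine squeeze_zero (fun n => Finset.prod_nonneg fun k _ => h0 k) (fun n => ?_)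
    (Real.tendsto_exp_neg_atTop_nhds_zero.comp ht)
  rw [Function.comp, ← Finset.sum_neg_distrib, Real.exp_sum]
  refine Finset.prod_le_prod (fun k _ => h0 k) fun k _ => ?_
  linarith [Real.add_one_le_exp (-(1 - x k))]

/-- Transfers divergence from the zeros to the values at a fixed `z`. In the Schwarz–Pick identity
`|1 - conj a · z| ≤ 2` and `1 - x² ≤ 2(1 - x)`, whence `8 = 2 · 2²`. -/
theorem DiscAut.one_sub_norm_a_le (χ : DiscAut) (z : 𝔻) :
    1 - ‖(χ.a : ℂ)‖ ≤ 8 / (1 - ‖(z : ℂ)‖ ^ 2) * (1 - ‖(χ z : ℂ)‖) := by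
  have hz := z.norm_lt_one
  have ha := χ.a.norm_lt_one
  have ha0 := norm_nonneg (χ.a : ℂ)
  have hz0 := norm_nonneg (z : ℂ)
  have hz2 : 0 < 1 - ‖(z : ℂ)‖ ^ 2 := by nlinarith
  have h := χ.one_sub_norm_formula_sq hz.le
  have hd : 0 < ‖1 - conj (χ.a : ℂ) * z‖ := norm_pos_iff.2 (χ.denominator_ne_zero hz.le)
  have hd2 : ‖1 - conj (χ.a : ℂ) * z‖ ≤ 2 := by
    have h1 := norm_sub_le (1 : ℂ) (conj (χ.a : ℂ) * z)
    rw [norm_one, norm_mul, RCLike.norm_conj] at h1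
    nlinarith
  have hx := (χ z).norm_lt_one
  rw [coe_apply] at hx ⊢
  have hx0 := norm_nonneg (χ.formula z)
  rw [eq_div_iff (by positivity)] at h
  rw [div_mul_eq_mul_div, le_div_iff₀ hz2]
  calc (1 - ‖(χ.a : ℂ)‖) * (1 - ‖(z : ℂ)‖ ^ 2)
      ≤ (1 - ‖(χ.a : ℂ)‖ ^ 2) * (1 - ‖(z : ℂ)‖ ^ 2) :=
        mul_le_mul_of_nonneg_right (by nlinarith) hz2.le
    _ = (1 - ‖χ.formula z‖ ^ 2) * ‖1 - conj (χ.a : ℂ) * z‖ ^ 2 := h.symm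
    _ ≤ (2 * (1 - ‖χ.formula z‖)) * 2 ^ 2 := by
        gcongr
        nlinarith
    _ = 8 * (1 - ‖χ.formula z‖) := by ring

theorem iInf_map_S_pow_eq_bot {p : ℝ} (hp : 1 ≤ p) (ψ φ : DiscAut) {χ : ℕ → DiscAut}
    (hχ : ∀ k z, χ k z = ψ (φ^[k] z)) (ha : ¬ IsBlaschkeSeq fun k => (χ k).a) :
    (⨅ n : ℕ, ⨅ _ : 1 ≤ n, (Hp p hp).map (S p ψ φ ^ n)) = ⊥ := by
  rw [eq_bot_iff]
  intro f hf
  simp only [Submodule.mem_iInf] at hf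
  rw [Submodule.mem_bot]
  funext z
  have hp0 : 0 < p := by linarith
  have hz : 0 < 1 - normSq (z : ℂ) := sub_pos.2 z.normSq_lt_one
  set C : ℝ := (normPow p f / (1 - normSq (z : ℂ))) ^ (1 / p)
  have hbound : ∀ n, 1 ≤ n → ‖f z‖ ≤ (∏ k ∈ Finset.range n, ‖(χ k z : ℂ)‖) * C := by
    intro n hn
    obtain ⟨g, hg, hgf⟩ := hf n hn
    have hU := memHp_pow (fun _ => memHp_U hp φ) n hg
    have h1 := one_sub_sq_mul_norm_rpow_le hp hU z
    rw [normPow_pow (fun _ => memHp_U hp φ) (fun _ => normPow_U hp φ) n hg,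
      ← normPow_pow (fun _ => memHp_S hp ψ φ) (fun _ => normPow_S hp ψ φ) n hg, hgf,
      mul_comm, ← le_div_iff₀ hz] at h1
    have h2 : ‖(U p φ ^ n) g z‖ ≤ C := by
      have := Real.rpow_le_rpow (by positivity) h1 (one_div_nonneg.2 hp0.le)
      rwa [← Real.rpow_mul (norm_nonneg _), mul_one_div_cancel hp0.ne', Real.rpow_one] at this
    rw [← hgf, S_pow_apply, norm_mul, norm_prod]
    simp only [hχ]
    exact mul_le_mul_of_nonneg_left h2 (Finset.prod_nonneg fun _ _ => norm_nonneg _)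
  have hns : ¬ Summable fun k => 1 - ‖(χ k z : ℂ)‖ := fun hs =>
    ha ((hs.mul_left (8 / (1 - ‖(z : ℂ)‖ ^ 2))).of_nonneg_of_le
      (fun k => sub_nonneg.2 (χ k).a.norm_lt_one.le) fun k => (χ k).one_sub_norm_a_le z)
  have ht := (tendsto_prod_zero_of_not_summable (fun k => norm_nonneg _)
    (fun k => (χ k z).norm_lt_one.le) hns).mul_const C
  rw [zero_mul] at ht
  exact norm_le_zero_iff.1 (ge_of_tendsto ht ((eventually_ge_atTop 1).mono hbound))

/-! ### The Blaschke case -/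

/-- The usual normalisation of a Blaschke factor: for `a ≠ 0`, `c` makes the value at 0 equal to
`|a|`, and then `cχ - 1` carries an explicit factor `1 - |a|`. For `a = 0` the bound is at least 2,
and `c = 1` suffices. -/
theorem DiscAut.exists_unimodular (χ : DiscAut) : ∃ c : ℂ, ‖c‖ = 1 ∧ ∀ z : ℂ, ‖z‖ < 1 →
    ‖c * χ.formula z - 1‖ ≤ 2 / (1 - ‖z‖) * (1 - ‖(χ.a : ℂ)‖) := by
  by_cases h0 : (χ.a : ℂ) = 0
  · refine ⟨1, norm_one, fun z hz => ?_⟩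
    rw [h0, norm_zero, sub_zero, mul_one, one_mul, le_div_iff₀ (sub_pos.2 hz)]
    have h1 := norm_sub_le (χ.formula z) 1
    rw [norm_one] at h1
    nlinarith [χ.norm_formula_lt_one' hz, norm_nonneg (χ.formula z - 1), norm_nonneg z]
  · have hN : ‖(χ.a : ℂ)‖ ≠ 0 := norm_ne_zero_iff.2 h0
    have hNc : ((‖(χ.a : ℂ)‖ : ℝ) : ℂ) ≠ 0 := ofReal_ne_zero.2 hN
    refine ⟨-(conj (χ.lam : ℂ) * conj (χ.a : ℂ) / ‖(χ.a : ℂ)‖), ?_, fun z hz => ?_⟩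
    · rw [norm_neg, norm_div, norm_mul, RCLike.norm_conj, RCLike.norm_conj, Circle.norm_coe,
        norm_real, norm_norm, one_mul, div_self hN]
    · have hd := χ.denominator_ne_zero hz.le
      have ha := χ.a.norm_lt_one
      have hsq : (χ.a : ℂ) * conj (χ.a : ℂ) = (‖(χ.a : ℂ)‖ : ℂ) ^ 2 := by
        rw [Complex.mul_conj, normSq_eq_norm_sq, ofReal_pow]
      have key : -(conj (χ.lam : ℂ) * conj (χ.a : ℂ) / ‖(χ.a : ℂ)‖) * χ.formula z - 1 =
          -(((1 - ‖(χ.a : ℂ)‖ : ℝ) : ℂ) * (‖(χ.a : ℂ)‖ + conj (χ.a : ℂ) * z) /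
            (‖(χ.a : ℂ)‖ * (1 - conj (χ.a : ℂ) * z))) := by
        rw [formula, ← neg_div, ← neg_div, div_mul_div_comm, sub_eq_iff_eq_add,
          div_eq_iff (mul_ne_zero hNc hd), add_mul, div_mul_cancel₀ _ (mul_ne_zero hNc hd)]
        push_cast
        linear_combination (-conj (χ.a : ℂ) * (z - χ.a)) * χ.conj_lam_mul_lam + hsq
      have hden : 1 - ‖z‖ ≤ ‖1 - conj (χ.a : ℂ) * z‖ := by
        have h1 := norm_sub_norm_le (1 : ℂ) (conj (χ.a : ℂ) * z)
        rw [norm_one, norm_mul, RCLike.norm_conj] at h1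
        nlinarith [norm_nonneg z]
      have hnum : ‖(‖(χ.a : ℂ)‖ : ℂ) + conj (χ.a : ℂ) * z‖ ≤ ‖(χ.a : ℂ)‖ * 2 := by
        have h1 := norm_add_le (‖(χ.a : ℂ)‖ : ℂ) (conj (χ.a : ℂ) * z)
        rw [norm_real, norm_norm, norm_mul, RCLike.norm_conj] at h1
        nlinarith [norm_nonneg (χ.a : ℂ)]
      have hz' := sub_pos.2 hz
      have ha' := sub_pos.2 ha
      have hNpos : 0 < ‖(χ.a : ℂ)‖ := norm_pos_iff.2 h0
      rw [key, norm_neg, norm_div, norm_mul, norm_mul, norm_real, norm_real, norm_norm,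
        Real.norm_of_nonneg ha'.le]
      calc (1 - ‖(χ.a : ℂ)‖) * ‖(‖(χ.a : ℂ)‖ : ℂ) + conj (χ.a : ℂ) * z‖ /
            (‖(χ.a : ℂ)‖ * ‖1 - conj (χ.a : ℂ) * z‖)
          ≤ (1 - ‖(χ.a : ℂ)‖) * (‖(χ.a : ℂ)‖ * 2) / (‖(χ.a : ℂ)‖ * (1 - ‖z‖)) := by gcongr
        _ = 2 / (1 - ‖z‖) * (1 - ‖(χ.a : ℂ)‖) := by
            field_simp

/-- Convergence of a Blaschke product. -/
theorem exists_blaschke_product {χ : ℕ → DiscAut} (ha : IsBlaschkeSeq fun k => (χ k).a) :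
    ∃ (c : ℕ → ℂ) (T : ℕ → ℂ → ℂ), (∀ n, DifferentiableOn ℂ (T n) (ball 0 1)) ∧
      (∀ n (z : 𝔻), ‖T n z‖ ≤ 1) ∧ (∀ k, ‖c k‖ = 1) ∧
      (∀ n (z : 𝔻), T 0 z = (∏ k ∈ Finset.range n, c k * χ k z) * T n z) ∧
      ∃ z : 𝔻, T 0 z ≠ 0 := by
  choose c hc1 hc using fun k => (χ k).exists_unimodular
  have hsum : ∀ n (z : 𝔻), Summable fun k => ‖c (k + n) * (χ (k + n)).formula z - 1‖ := fun n z =>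
    (((summable_nat_add_iff n).2 ha).mul_left (2 / (1 - ‖(z : ℂ)‖))).of_nonneg_of_le
      (fun _ => norm_nonneg _) fun k => hc (k + n) z z.norm_lt_one
  have hmul : ∀ n (z : 𝔻), Multipliable fun k => c (k + n) * (χ (k + n)).formula z := fun n z => by
    simpa using multipliable_one_add_of_summable (hsum n z)
  -- `T n` is the tail of the product from index `n` on.
  refine ⟨c, fun n z => ∏' k, c (k + n) * (χ (k + n)).formula z, fun n => ?_, fun n z => ?_, hc1,
    fun n z => ?_, ?_⟩
  · have hd : ∀ k, DifferentiableOn ℂ (fun z => c k * (χ k).formula z) (ball 0 1) := fun k z hz =>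
      (((χ k).differentiableAt_formula
        (mem_ball_zero_iff.1 hz).le).const_mul (c k)).differentiableWithinAt
    have hlu : HasProdLocallyUniformlyOn (fun k z => c (k + n) * (χ (k + n)).formula z)
        (fun z => ∏' k, c (k + n) * (χ (k + n)).formula z) (ball 0 1) := by
      refine hasProdLocallyUniformlyOn_of_forall_compact isOpen_ball fun K hK hcK => ?_
      obtain ⟨ρ, hρ1, hρ⟩ : ∃ ρ < 1, ∀ z ∈ K, ‖z‖ ≤ ρ := by
        rcases K.eq_empty_or_nonempty with rfl | hN
        · exact ⟨0, zero_lt_one, by simp⟩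
        · obtain ⟨w, hw, hmax⟩ := hcK.exists_isMaxOn hN continuous_norm.continuousOn
          exact ⟨‖w‖, mem_ball_zero_iff.1 (hK hw), fun z hz => hmax hz⟩
      have := (((summable_nat_add_iff n).2 ha).mul_left
        (2 / (1 - ρ))).hasProdUniformlyOn_nat_one_add
        (f := fun k z => c (k + n) * (χ (k + n)).formula z - 1) hcK
        (.of_forall fun k z hz => ?_) fun k => ((hd (k + n)).continuousOn.mono hK).sub
          continuousOn_const
      · simpa using this
      · refine (hc (k + n) z (mem_ball_zero_iff.1 (hK hz))).trans ?_
        have h1 := sub_pos.2 hρ1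
        have h2 := sub_nonneg.2 (χ (k + n)).a.norm_lt_one.le
        have h3 := hρ z hz
        gcongr
    refine hlu.differentiableOn (.of_forall fun s => ?_) isOpen_ball
    simpa [Finset.prod_fn] using DifferentiableOn.finsetProd fun k _ => hd (k + n)
  · refine le_of_tendsto (hmul n z).hasProd.norm (.of_forall fun s => ?_)
    refine Finset.prod_le_one (fun _ _ => norm_nonneg _) fun k _ => ?_
    simp only [norm_mul, hc1, one_mul]
    exact ((χ (k + n)).norm_formula_lt_one z).le
  · have h := hmul n z
    exact (Multipliable.prod_mul_tprod_nat_mul' (f := fun k => c k * (χ k).formula z) h).symm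
  · have hcount : (Set.range fun k => ((χ k).a : ℂ)).Countable := Set.countable_range _
    obtain ⟨w, hw, hwc⟩ := (hcount.dense_compl ℝ).exists_mem_open isOpen_ball
      (⟨0, by simp⟩ : (ball (0 : ℂ) 1).Nonempty)
    refine ⟨UnitDisc.mk w (mem_ball_zero_iff.1 hwc), ?_⟩
    have := tprod_one_add_ne_zero_of_summable
      (f := fun k => c (k + 0) * (χ (k + 0)).formula (UnitDisc.mk w (mem_ball_zero_iff.1 hwc)) - 1)
      (fun k => ?_) (hsum 0 _)
    · simpa using this
    · rw [add_sub_cancel]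
      refine mul_ne_zero (norm_ne_zero_iff.1 (by rw [hc1]; exact one_ne_zero)) fun h => hw ⟨k, ?_⟩
      have h' := ((χ k).apply_eq_zero_iff (UnitDisc.mk w (mem_ball_zero_iff.1 hwc))).1
        (UnitDisc.coe_eq_zero.1 h)
      simp [← h']

theorem iInf_map_S_pow_ne_bot {p : ℝ} (hp : 1 ≤ p) (ψ φ : DiscAut) {χ : ℕ → DiscAut}
    (hχ : ∀ k z, χ k z = ψ (φ^[k] z)) (ha : IsBlaschkeSeq fun k => (χ k).a) :
    (⨅ n : ℕ, ⨅ _ : 1 ≤ n, (Hp p hp).map (S p ψ φ ^ n)) ≠ ⊥ := by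
  obtain ⟨c, T, hTd, hTb, hc, hT, w, hw⟩ := exists_blaschke_product ha
  refine (Submodule.ne_bot_iff _).2 ⟨fun z : 𝔻 => T 0 z, ?_, fun h => hw (congrFun h w)⟩
  simp only [Submodule.mem_iInf]
  intro n _
  -- The quotient of `T 0` by `∏_{k<n} χ k`: the tail `T n` times the normalising constants. Its
  -- preimage under `U^n` is the required preimage of `T 0` under `S^n`.
  have hmem : MemHp p fun z : 𝔻 => (∏ k ∈ Finset.range n, c k) * T n z := by
    refine memHp_of_bounded hp (C := 1) (isAnalytic_of_eq
      (F := fun z => (∏ k ∈ Finset.range n, c k) * T n z) ((hTd n).const_mul _) fun _ => rfl) ?_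
    intro z
    simpa [norm_mul, norm_prod, hc] using hTb n z
  obtain ⟨g, hg, hgU⟩ := exists_U_pow_eq hp φ n hmem
  refine ⟨g, hg, funext fun z => ?_⟩
  rw [S_pow_apply, hgU, hT n z, Finset.prod_mul_distrib]
  simp only [hχ]
  ring

end HardyIsometry

end

theorem theorem2 (p : ℝ) (hp : 1 ≤ p) (φ ψ : HardyIsometry.DiscAut) :
    HardyIsometry.IsCodimOneIsometry p hp (HardyIsometry.S p ψ φ) ∧
    ∃ a : ℕ → Complex.UnitDisc, (∀ (k : ℕ) (w : Complex.UnitDisc), ψ (φ^[k] w) = 0 ↔ w = a k) ∧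
      (HardyIsometry.IsCrownover p hp (HardyIsometry.S p ψ φ) ↔
        ¬ HardyIsometry.IsBlaschkeSeq a) := by
  have hS := HardyIsometry.isCodimOneIsometry_S hp ψ φ
  choose χ hχ using HardyIsometry.DiscAut.exists_comp_iterate ψ φ
  refine ⟨hS, fun k => (χ k).a, fun k w => ?_, fun h hB => ?_, fun h => ⟨hS, ?_⟩⟩
  · rw [← hχ, HardyIsometry.DiscAut.apply_eq_zero_iff]
  · exact HardyIsometry.iInf_map_S_pow_ne_bot hp ψ φ hχ hB h.2
  · exact HardyIsometry.iInf_map_S_pow_eq_bot hp ψ φ hχ h
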